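/- Theorem. A graph is a biclique if its vertex set can be partitioned into two disjoint non-empty independent sets $V_1,V_2$ such that every vertex of $V_1$ is adjacent to every vertex of $V_2$. A bicluster graph is a graph in which every connected component with at least two vertices is a biclique. Bicluster Editing is the problem of deciding, given a finite simple graph $G$ and an integer $k\ge 0$, whether $G$ can be transformed into a bicluster graph by adding and removing at most $k$ edges. There is an algorithm that decides Bicluster Editing in time $O^*(3.116^k)$. That is, there are a single deterministic random access machine program (with logarithmic cost, $G$ being given by its adjacency matrix and $k$ as a number) and constants $C,d$ such that, for every $n\ge 0$, every graph $G$ on $n$ vertices and every $k\ge 0$, the program halts on input $(G,k)$ with the correct answer after time at most $C\cdot 3.116^k\cdot(n+\mathrm{size}(k)+1)^d$, where $\mathrm{size}(k)$ is the number of binary digits of $k$. -/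

import Mathlib

/-! ## Bicluster graphs and Bicluster Editing -/

/-- A biclique (complete bipartite graph): the vertex set is partitioned into two disjoint non-empty
independent sets `V₁`, `V₂`, and every vertex of `V₁` is adjacent to every vertex of `V₂`. -/
def IsBiclique {V : Type*} (G : SimpleGraph V) : Prop :=
  ∃ V₁ V₂ : Set V, V₁.Nonempty ∧ V₂.Nonempty ∧ Disjoint V₁ V₂ ∧ V₁ ∪ V₂ = Set.univ ∧
    (∀ u ∈ V₁, ∀ v ∈ V₁, ¬ G.Adj u v) ∧ (∀ u ∈ V₂, ∀ v ∈ V₂, ¬ G.Adj u v) ∧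
    (∀ u ∈ V₁, ∀ v ∈ V₂, G.Adj u v)

/-- A bicluster graph: every connected component with at least two vertices is a biclique. -/
def IsBicluster {V : Type*} (G : SimpleGraph V) : Prop :=
  ∀ c : G.ConnectedComponent, c.supp.Nontrivial → IsBiclique (G.induce c.supp)

/-- `G △ F`: the graph with edge set `(E ∖ F) ∪ (F ∖ E)`. -/
def editGraph {V : Type*} (G : SimpleGraph V) (F : Finset (Sym2 V)) : SimpleGraph V :=
  SimpleGraph.fromEdgeSet (symmDiff G.edgeSet (F : Set (Sym2 V)))

/-- `(G, k)` is a yes-instance of Bicluster Editing: adding and removing at most `k` edges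
can turn `G` into a bicluster graph. -/
def BiclusterEditing {V : Type*} (G : SimpleGraph V) (k : ℕ) : Prop :=
  ∃ F : Finset (Sym2 V), (∀ e ∈ F, ¬ e.IsDiag) ∧ F.card ≤ k ∧ IsBicluster (editGraph G F)

/-! ## Random access machine programs with logarithmic cost

Programs are structured (`while`) programs over registers and arrays holding natural numbers.
Every operation is charged the bit length of all the numbers (values and addresses) it handles,
so the unbounded word length cannot be exploited. -/

namespace RAM

/-- The memory: registers `reg x` and arrays `arr a`, the latter with indirect addressing. -/
structure State where
  reg : ℕ → ℕ
  arr : ℕ → ℕ → ℕ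

/-- Binary machine operations. -/
inductive Op
  | add
  | sub
  | mul
  | div
  | lt
  | eq

/-- Subtraction is truncated, division is integer division (by zero it gives `0`), and
comparisons return `1` (true) or `0` (false). -/
def Op.eval : Op → ℕ → ℕ → ℕ
  | .add, m, n => m + n
  | .sub, m, n => m - n
  | .mul, m, n => m * n
  | .div, m, n => m / n
  | .lt, m, n => if m < n then 1 else 0
  | .eq, m, n => if m = n then 1 else 0

/-- Expressions: constants, registers, array entries `a[i]`, and operations. -/
inductive Expr
  | const (c : ℕ)
  | reg (x : ℕ)
  | get (a : ℕ) (i : Expr)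
  | op (o : Op) (e₁ e₂ : Expr)

/-- The value of an expression. -/
def Expr.eval (s : State) : Expr → ℕ
  | .const c => c
  | .reg x => s.reg x
  | .get a i => s.arr a (i.eval s)
  | .op o e₁ e₂ => o.eval (e₁.eval s) (e₂.eval s)

/-- The time to evaluate an expression: every node costs `1` plus the bit length of its value
(`Nat.size` is the length of the binary representation). -/
def Expr.cost (s : State) : Expr → ℕ
  | .const c => 1 + Nat.size c
  | .reg x => 1 + Nat.size (s.reg x)
  | .get a i => 1 + Nat.size (s.arr a (i.eval s)) + i.cost s
  | .op o e₁ e₂ => 1 + Nat.size (o.eval (e₁.eval s) (e₂.eval s)) + e₁.cost s + e₂.cost s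

/-- Programs. `set x e` is `x := e`, and `put a i e` is `a[i] := e`. -/
inductive Program
  | skip
  | set (x : ℕ) (e : Expr)
  | put (a : ℕ) (i e : Expr)
  | seq (p q : Program)
  | ite (e : Expr) (p q : Program)
  | while (e : Expr) (p : Program)

/-- The state after `x := v`. -/
def State.setReg (s : State) (x v : ℕ) : State :=
  { s with reg := Function.update s.reg x v }

/-- The state after `a[i] := v`. -/
def State.setArr (s : State) (a i v : ℕ) : State :=
  { s with arr := Function.update s.arr a (Function.update (s.arr a) i v) }

/-- `Exec p s s' t`: started in state `s`, the (deterministic) program `p` halts in state `s'`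
after time exactly `t`. A test succeeds if its value is non-zero. -/
inductive Exec : Program → State → State → ℕ → Prop
  | skip (s : State) : Exec .skip s s 1
  | set (s : State) (x : ℕ) (e : Expr) :
      Exec (.set x e) s (s.setReg x (e.eval s)) (1 + e.cost s)
  | put (s : State) (a : ℕ) (i e : Expr) :
      Exec (.put a i e) s (s.setArr a (i.eval s) (e.eval s)) (1 + i.cost s + e.cost s)
  | seq {p q : Program} {s s' s'' : State} {t t' : ℕ} :
      Exec p s s' t → Exec q s' s'' t' → Exec (.seq p q) s s'' (t + t')
  | ite_true {e : Expr} {p q : Program} {s s' : State} {t : ℕ} :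
      e.eval s ≠ 0 → Exec p s s' t → Exec (.ite e p q) s s' (1 + e.cost s + t)
  | ite_false {e : Expr} {p q : Program} {s s' : State} {t : ℕ} :
      e.eval s = 0 → Exec q s s' t → Exec (.ite e p q) s s' (1 + e.cost s + t)
  | while_true {e : Expr} {p : Program} {s s' s'' : State} {t t' : ℕ} :
      e.eval s ≠ 0 → Exec p s s' t → Exec (.while e p) s' s'' t' →
      Exec (.while e p) s s'' (1 + e.cost s + t + t')
  | while_false {e : Expr} {p : Program} {s : State} :
      e.eval s = 0 → Exec (.while e p) s s (1 + e.cost s)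

/-- `p` halts on the initial state `s` within time `T`, with `1` in register `0` if `Q` is true
and `0` in register `0` if `Q` is false. -/
def DecidesWithin (p : Program) (s : State) (Q : Prop) (T : ℝ) : Prop :=
  ∃ (s' : State) (t : ℕ), Exec p s s' t ∧ (t : ℝ) ≤ T ∧
    (Q → s'.reg 0 = 1) ∧ (¬ Q → s'.reg 0 = 0)

open Classical in
/-- The initial state for an instance `(G, k)`, where `G` has vertices `0, …, n - 1`: register `0`
holds `n`, register `1` holds `k`, and array `0` holds the adjacency matrix of `G` row by row
(entry `i * n + j` is `1` if `i` and `j` are adjacent). All other cells hold `0`. -/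
noncomputable def input {n : ℕ} (G : SimpleGraph (Fin n)) (k : ℕ) : State where
  reg x := if x = 0 then n else if x = 1 then k else 0
  arr a m := if a = 0 ∧ ∃ i j : Fin n, m = i * n + j ∧ G.Adj i j then 1 else 0

end RAM

/-! ## Bicluster graphs as graphs in which every walk of length three closes up -/

/-! A graph is a bicluster graph exactly when every walk `a b c d` closes up, that is, `a` and `d`
are adjacent (`isBicluster_iff`). A walk that does not close up forces an edit on one of the pairs
`ab`, `bc`, `cd`, `ad`, so branching four ways is immediate. Finer rules lower the base from 4 to 3,
and the gap between 3 and 3.116 absorbs every factor that is polynomial in `k`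
(`exists_three_pow_mul_le`).

Give a branch with `m` edits the weight `3 ^ (-m)`. In each rule the weights sum to at most 1. (1) A
triangle has three branches of one edit. (2) For an open walk from a vertex of degree one, and for a
path through three consecutive vertices of degree two with distinct ends, the pair `ad` can be
dispensed with. If a solution uses it, a few vertices can be cut out as a separate biclique at no
extra cost (`ncard_edits_withBiclique`). (3) In a bicluster graph, vertices with a common neighbour
are twins. So for non-adjacent `u`, `v`, a solution edits the adjacency to `u` or `v` either of all
their common neighbours or of all vertices that distinguish them. With `c` and `d` such vertices the
weight is `(2/3)^c + (2/3)^d`, which is below 1 for `(1, 3)`, `(2, 2)` and `(3, 1)`. (4) A component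
that is `K₃,₃` minus one edge or minus two disjoint edges is completed without branching.

These rules suffice (`Irreducible.walkClosed`). When the twin rules do not apply, an open walk `a b
c d` has `deg a = 2` and `deg c ≤ 3`, and following the walks around it leads to the path of (2) or
to a component of (4).

The program keeps no stack. It enumerates the numbers `r < 3 ^ k` and reads the ternary digits of
`r` as instructions: a branch with `m` edits consumes `m` digits, and the weight condition leaves
room for a prefix code. Some `r` is accepted if and only if the instance is a yes-instance
(`biclusterEditing_iff_exists_accepts`). One guess takes polynomially many steps on numbers of `O(n
+ k)` bits. -/

namespace Bicluster

variable {V : Type*}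

/-- Every walk of length three joins adjacent vertices: the graph has neither triangles nor
induced paths on four vertices. -/
def WalkClosed (H : SimpleGraph V) : Prop :=
  ∀ a b c d, H.Adj a b → H.Adj b c → H.Adj c d → H.Adj a d

/-- Any edge `xy` of the component determines the bipartition: the sides are the neighbours of `y`
and the neighbours of `x`. -/
theorem WalkClosed.isBicluster {H : SimpleGraph V} (hH : WalkClosed H) : IsBicluster H := by
  intro c hc
  obtain ⟨p, hp, q, hq, hpq⟩ := hc
  have hreach : ∀ x ∈ c.supp, ∀ y ∈ c.supp, H.Reachable x y := fun x hx y hy =>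
    SimpleGraph.ConnectedComponent.exact (by
      rw [SimpleGraph.ConnectedComponent.mem_supp_iff] at hx hy; rw [hx, hy])
  obtain ⟨x, hx, y, hy, hxy⟩ : ∃ x ∈ c.supp, ∃ y ∈ c.supp, H.Adj x y := by
    obtain ⟨w⟩ := hreach p hp q hq
    cases w with
    | nil => exact absurd rfl hpq
    | cons h _ => exact ⟨_, hp, _, (SimpleGraph.ConnectedComponent.mem_supp_congr_adj c h).1 hp, h⟩
  -- The property propagates along edges: a neighbour of a neighbour of `y` starts a walk of length
  -- three to `x`, and vice versa.
  have hside : ∀ z, H.Reachable x z → H.Adj z y ∨ H.Adj z x := by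
    rintro z hz
    rw [SimpleGraph.reachable_iff_reflTransGen] at hz
    induction hz with
    | refl => exact Or.inl hxy
    | tail _ h ih =>
      rcases ih with ih | ih
      · exact Or.inr (hH _ _ _ _ h.symm ih hxy.symm)
      · exact Or.inl (hH _ _ _ _ h.symm ih hxy)
  refine ⟨{z | H.Adj z y}, {z | H.Adj z x}, ⟨⟨x, hx⟩, hxy⟩, ⟨⟨y, hy⟩, hxy.symm⟩, ?_, ?_, ?_, ?_, ?_⟩
  · rw [Set.disjoint_left]
    intro z hz hz'
    exact H.irrefl (hH _ _ _ _ hz' hxy (SimpleGraph.Adj.symm hz))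
  · ext z
    simpa using hside z (hreach x hx z z.2)
  · intro u hu v hv h
    exact H.irrefl (hH _ _ _ _ h hv (SimpleGraph.Adj.symm hu))
  · intro u hu v hv h
    exact H.irrefl (hH _ _ _ _ h hv (SimpleGraph.Adj.symm hu))
  · intro u hu v hv
    exact hH _ _ _ _ hu hxy.symm (SimpleGraph.Adj.symm hv)

/-- Conversely, a walk in a biclique alternates between the sides, so after three steps it is on the
opposite side, where every vertex is adjacent to its start. -/
theorem isBicluster_iff {H : SimpleGraph V} : IsBicluster H ↔ WalkClosed H := by
  refine ⟨fun h a b c d hab hbc hcd => ?_, WalkClosed.isBicluster⟩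
  set K := H.connectedComponentMk a
  have ha : a ∈ K.supp := rfl
  have hb := (SimpleGraph.ConnectedComponent.mem_supp_congr_adj K hab).1 ha
  have hc := (SimpleGraph.ConnectedComponent.mem_supp_congr_adj K hbc).1 hb
  have hd := (SimpleGraph.ConnectedComponent.mem_supp_congr_adj K hcd).1 hc
  obtain ⟨V₁, V₂, -, -, -, hun, h1, h2, h12⟩ := h K ⟨a, ha, b, hb, hab.ne⟩
  have hmem : ∀ z : K.supp, z ∈ V₁ ∨ z ∈ V₂ := fun z => by
    have : z ∈ V₁ ∪ V₂ := hun ▸ Set.mem_univ z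
    exact this
  have step1 : ∀ x y : K.supp, H.Adj x y → x ∈ V₁ → y ∈ V₂ := fun x y hxy hx =>
    (hmem y).resolve_left fun hy => h1 x hx y hy hxy
  have step2 : ∀ x y : K.supp, H.Adj x y → x ∈ V₂ → y ∈ V₁ := fun x y hxy hx =>
    (hmem y).resolve_right fun hy => h2 x hx y hy hxy
  rcases hmem ⟨a, ha⟩ with h | h
  · exact h12 _ h _ (step1 ⟨c, hc⟩ ⟨d, hd⟩ hcd
      (step2 ⟨b, hb⟩ ⟨c, hc⟩ hbc (step1 ⟨a, ha⟩ ⟨b, hb⟩ hab h)))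
  · exact (h12 _ (step2 ⟨c, hc⟩ ⟨d, hd⟩ hcd
      (step1 ⟨b, hb⟩ ⟨c, hc⟩ hbc (step2 ⟨a, ha⟩ ⟨b, hb⟩ hab h))) _ h).symm

/-! ## Edit sets and edit distance -/

/-- The pairs on which two graphs differ. -/
def edits (G H : SimpleGraph V) : Set (Sym2 V) := symmDiff G.edgeSet H.edgeSet

theorem mem_edits {G H : SimpleGraph V} {a b : V} :
    s(a, b) ∈ edits G H ↔ ¬ (G.Adj a b ↔ H.Adj a b) := by
  simp only [edits, Set.mem_symmDiff, SimpleGraph.mem_edgeSet]; tauto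

/-- A solution is treated as the target graph rather than as an edit set, so that the exchange
arguments can replace one target by another. -/
theorem biclusterEditing_iff [Finite V] {G : SimpleGraph V} {k : ℕ} :
    BiclusterEditing G k ↔ ∃ H, WalkClosed H ∧ (edits G H).ncard ≤ k := by
  constructor
  · rintro ⟨F, hF, hk, hH⟩
    refine ⟨editGraph G F, isBicluster_iff.1 hH, le_trans ?_ hk⟩
    rw [← Set.ncard_coe_finset F]
    refine Set.ncard_le_ncard ?_ (Set.toFinite _)
    intro e he
    induction e with | _ a b
    rw [mem_edits] at he
    by_contra hab
    apply he
    rw [editGraph, SimpleGraph.fromEdgeSet_adj, Set.mem_symmDiff, SimpleGraph.mem_edgeSet]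
    have := fun h : G.Adj a b => h.ne
    tauto
  · rintro ⟨H, hH, hk⟩
    refine ⟨(Set.toFinite (edits G H)).toFinset, ?_, ?_, ?_⟩
    · intro e he
      rw [Set.Finite.mem_toFinset] at he
      rcases he with he | he
      · exact G.not_isDiag_of_mem_edgeSet he.1
      · exact H.not_isDiag_of_mem_edgeSet he.1
    · rwa [← Set.ncard_eq_toFinset_card _ (Set.toFinite _)]
    · have : editGraph G (Set.toFinite (edits G H)).toFinset = H := by
        rw [editGraph, Set.Finite.coe_toFinset, edits, symmDiff_symmDiff_cancel_left,
          SimpleGraph.fromEdgeSet_edgeSet]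
      rw [this]
      exact isBicluster_iff.2 hH

/-! ### Editing pairs one at a time -/

/-- The graph obtained by changing the adjacency of `a` and `b`. -/
def toggle (G : SimpleGraph V) (a b : V) : SimpleGraph V :=
  SimpleGraph.fromEdgeSet (symmDiff G.edgeSet {s(a, b)})

theorem toggle_adj {G : SimpleGraph V} {a b x y : V} :
    (toggle G a b).Adj x y ↔ x ≠ y ∧ ¬ (G.Adj x y ↔ s(x, y) = s(a, b)) := by
  rw [toggle, SimpleGraph.fromEdgeSet_adj, Set.mem_symmDiff, SimpleGraph.mem_edgeSet,
    Set.mem_singleton_iff]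
  tauto

theorem ncard_edits_le_toggle [Finite V] (G H : SimpleGraph V) (a b : V) :
    (edits G H).ncard ≤ (edits (toggle G a b) H).ncard + 1 := by
  refine le_trans (Set.ncard_le_ncard ?_ (Set.toFinite _)) (Set.ncard_insert_le s(a, b) _)
  intro e he
  induction e with | _ x y
  rw [Set.mem_insert_iff, mem_edits, toggle_adj]
  rw [mem_edits] at he
  by_cases hxy : x = y
  · subst hxy; simp at he
  · tauto

theorem edits_toggle_subset {G H : SimpleGraph V} {a b : V} (h : s(a, b) ∈ edits G H) :
    edits (toggle G a b) H ⊆ edits G H \ {s(a, b)} := by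
  intro e he
  induction e with | _ x y
  rw [mem_edits, toggle_adj] at he
  by_cases hxy : x = y
  · subst hxy; simp at he
  by_cases hab : s(x, y) = s(a, b)
  · rw [hab] at he
    have h' : s(x, y) ∈ edits G H := hab ▸ h
    rw [mem_edits] at h'
    tauto
  · refine ⟨mem_edits.2 ?_, hab⟩
    tauto

/-- Changing the adjacency of all pairs in a list, one after the other. -/
def toggleList (G : SimpleGraph V) : List (V × V) → SimpleGraph V
  | [] => G
  | e :: L => toggleList (toggle G e.1 e.2) L

/-- Soundness of a branch. Each change moves the graph by distance at most one, so nothing is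
required of the pairs in `L`, which may repeat or be degenerate. -/
theorem biclusterEditing_of_toggleList [Finite V] (L : List (V × V)) :
    ∀ {G : SimpleGraph V} {k : ℕ}, BiclusterEditing (toggleList G L) k →
      BiclusterEditing G (k + L.length) := by
  induction L with
  | nil => intro G k h; exact h
  | cons e L ih =>
    intro G k h
    obtain ⟨H, hH, hk⟩ := biclusterEditing_iff.1 (ih h)
    refine biclusterEditing_iff.2 ⟨H, hH, ?_⟩
    have := ncard_edits_le_toggle G H e.1 e.2
    simp only [List.length_cons]
    omega

/-- Completeness of a branch: edits that belong to a solution each bring the graph one step closer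
to it. The pairs must be distinct as unordered pairs, since a second change would undo the first. -/
theorem ncard_edits_toggleList [Finite V] {H : SimpleGraph V} (L : List (V × V)) :
    ∀ {G : SimpleGraph V}, (∀ e ∈ L, s(e.1, e.2) ∈ edits G H) →
      (L.map fun e => s(e.1, e.2)).Nodup →
      (edits (toggleList G L) H).ncard + L.length ≤ (edits G H).ncard := by
  classical
  induction L with
  | nil => intro G _ _; exact le_rfl
  | cons e L ih =>
    intro G hL hnd
    rw [List.map_cons, List.nodup_cons] at hnd
    have he := hL e List.mem_cons_self
    have h1 : (edits (toggle G e.1 e.2) H).ncard + 1 ≤ (edits G H).ncard := by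
      have := Set.ncard_le_ncard (edits_toggle_subset he) (Set.toFinite _)
      have h2 := Set.ncard_sdiff_singleton_add_one he (Set.toFinite _)
      omega
    have h2 := ih (G := toggle G e.1 e.2) (fun f hf => by
      have hne : s(f.1, f.2) ≠ s(e.1, e.2) := fun h => hnd.1 (h ▸ List.mem_map_of_mem hf)
      have hfe := hL f (List.mem_cons_of_mem _ hf)
      rw [mem_edits] at hfe ⊢
      rw [toggle_adj]
      have : f.1 ≠ f.2 := fun h => by rw [h] at hfe; simp at hfe
      tauto) hnd.2
    simp only [toggleList, List.length_cons]
    omega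

/-! ## Replacing a solution near a set of vertices by a separate biclique -/

/-- `H`, with the vertices of `A ∪ B` cut out and made a complete bipartite graph with sides `A`
and `B`. -/
def withBiclique (H : SimpleGraph V) (A B : Set V) (hAB : Disjoint A B) : SimpleGraph V where
  Adj x y := (x ∉ A ∪ B ∧ y ∉ A ∪ B ∧ H.Adj x y) ∨ (x ∈ A ∧ y ∈ B) ∨ (x ∈ B ∧ y ∈ A)
  symm := ⟨fun x y h => by
    rcases h with ⟨hx, hy, h⟩ | h | h
    · exact Or.inl ⟨hy, hx, h.symm⟩
    · exact Or.inr (Or.inr h.symm)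
    · exact Or.inr (Or.inl h.symm)⟩
  loopless := ⟨fun x h => by
    rcases h with ⟨-, -, h⟩ | h | h
    · exact H.irrefl h
    · exact Set.disjoint_left.1 hAB h.1 h.2
    · exact Set.disjoint_left.1 hAB h.2 h.1⟩

/-- No edge leaves `A ∪ B`, so a walk either stays outside, where the graph is `H`, or alternates
between `A` and `B`. -/
theorem WalkClosed.withBiclique {H : SimpleGraph V} (hH : WalkClosed H) {A B : Set V}
    (hAB : Disjoint A B) : WalkClosed (withBiclique H A B hAB) := by
  have hdis : ∀ x, x ∈ A → x ∉ B := fun x h => Set.disjoint_left.1 hAB h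
  have inner : ∀ {x y}, (Bicluster.withBiclique H A B hAB).Adj x y →
      (x ∈ A ↔ y ∈ B) ∧ (x ∈ B ↔ y ∈ A) ∧ (x ∉ A ∪ B → H.Adj x y) := by
    rintro x y (⟨hx, hy, h⟩ | ⟨hx, hy⟩ | ⟨hx, hy⟩)
    · rw [Set.mem_union, not_or] at hx hy
      exact ⟨iff_of_false hx.1 hy.2, iff_of_false hx.2 hy.1, fun _ => h⟩
    · exact ⟨iff_of_true hx hy, iff_of_false (hdis x hx) fun h => hdis y h hy,
        fun h => absurd (Or.inl hx) h⟩
    · exact ⟨iff_of_false (fun h => hdis x h hx) (hdis y hy), iff_of_true hx hy,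
        fun h => absurd (Or.inr hx) h⟩
  intro a b c d hab hbc hcd
  obtain ⟨h1, h2, h3⟩ := inner hab
  obtain ⟨h4, h5, h6⟩ := inner hbc
  obtain ⟨h7, h8, h9⟩ := inner hcd
  by_cases haA : a ∈ A
  · exact Or.inr (Or.inl ⟨haA, h7.1 (h5.1 (h1.1 haA))⟩)
  by_cases haB : a ∈ B
  · exact Or.inr (Or.inr ⟨haB, h8.1 (h4.1 (h2.1 haB))⟩)
  have ha : a ∉ A ∪ B := fun h => h.elim haA haB
  have hb : b ∉ A ∪ B := fun h => h.elim (fun h => haB (h2.2 h)) fun h => haA (h1.2 h)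
  have hc : c ∉ A ∪ B := fun h => h.elim (fun h => hb (Or.inr (h5.2 h))) fun h => hb (Or.inl (h4.2 h))
  have hd : d ∉ A ∪ B := fun h => h.elim (fun h => hc (Or.inr (h8.2 h))) fun h => hc (Or.inl (h7.2 h))
  exact Or.inl ⟨ha, hd, hH a b c d (h3 ha) (h6 hb) (h9 hc)⟩

/-- If `A ∪ B` can be made a separate biclique by the edits in `E`, and a bicluster graph `H` needs
at least as many edits at the vertices of `A ∪ B`, then there is a solution as good as `H` that
makes `A ∪ B` a separate biclique. -/
theorem ncard_edits_withBiclique [Finite V] {G H : SimpleGraph V} {A B : Set V}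
    (hAB : Disjoint A B) (E E' : Finset (Sym2 V))
    (hA : ∀ x ∈ A, ∀ y, ¬ (G.Adj x y ↔ y ∈ B) → s(x, y) ∈ E)
    (hB : ∀ x ∈ B, ∀ y, ¬ (G.Adj x y ↔ y ∈ A) → s(x, y) ∈ E)
    (hE' : ∀ e ∈ E', e ∈ edits G H ∧ ∃ x ∈ A ∪ B, x ∈ e) (hcard : E.card ≤ E'.card) :
    (edits G (withBiclique H A B hAB)).ncard ≤ (edits G H).ncard := by
  have hE : ∀ x ∈ A ∪ B, ∀ y,
      ¬ (G.Adj x y ↔ (x ∈ A ∧ y ∈ B) ∨ (x ∈ B ∧ y ∈ A)) → s(x, y) ∈ E := by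
    rintro x (hx | hx) y h
    · have hx' : x ∉ B := Set.disjoint_left.1 hAB hx
      exact hA x hx y (by simpa [hx, hx'] using h)
    · have hx' : x ∉ A := Set.disjoint_right.1 hAB hx
      exact hB x hx y (by simpa [hx, hx'] using h)
  -- Pairs that meet `A ∪ B` cost at most `E`. All other pairs are as in `H`, and none of them lies
  -- in `E'`.
  have hsub : edits G (withBiclique H A B hAB) ⊆ (edits G H \ E') ∪ E := by
    intro e he
    induction e with | _ x y
    rw [mem_edits] at he
    by_cases hx : x ∈ A ∪ B
    · refine Or.inr (hE x hx y fun h => he (h.trans ?_))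
      simp only [withBiclique]
      tauto
    by_cases hy : y ∈ A ∪ B
    · rw [Sym2.eq_swap]
      refine Or.inr (hE y hy x fun h => he ((G.adj_comm x y).trans (h.trans ?_)))
      simp only [withBiclique, hy]
      tauto
    · left
      have h1 : (withBiclique H A B hAB).Adj x y ↔ H.Adj x y := by
        simp only [withBiclique]
        simp only [Set.mem_union] at hx hy ⊢
        tauto
      rw [h1, ← mem_edits] at he
      refine ⟨he, fun h => ?_⟩
      obtain ⟨z, hz, hzxy⟩ := (hE' _ h).2
      rcases Sym2.mem_iff.1 hzxy with rfl | rfl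
      · exact hx hz
      · exact hy hz
  have h1 := Set.ncard_le_ncard hsub (Set.toFinite _)
  have h2 := Set.ncard_union_le (edits G H \ E') (E : Set (Sym2 V))
  have h3 := Set.ncard_sdiff_add_ncard_of_subset (s := (E' : Set (Sym2 V))) (t := edits G H)
    (fun e he => (hE' e he).1) (Set.toFinite _)
  rw [Set.ncard_coe_finset] at h2 h3
  omega

end Bicluster


/-! ## Exchange arguments -/

namespace Bicluster

variable {V : Type*}

open Classical in
/-- The set of neighbours of a vertex. -/
noncomputable def nbr [Fintype V] (G : SimpleGraph V) (v : V) : Finset V :=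
  Finset.univ.filter (G.Adj v)

theorem mem_nbr [Fintype V] {G : SimpleGraph V} {v w : V} : w ∈ nbr G v ↔ G.Adj v w := by
  simp [nbr]

/-- A degree condition together with enough known neighbours pins down the whole neighbourhood. This
is how a pattern on six vertices can certify a separate component. -/
theorem adj_iff_of_card_nbr [Fintype V] {G : SimpleGraph V} {v : V} (S : Finset V)
    (hS : ∀ w ∈ S, G.Adj v w) (hcard : (nbr G v).card ≤ S.card) (w : V) : G.Adj v w ↔ w ∈ S := by
  have : S = nbr G v := Finset.eq_of_subset_of_card_le (fun w hw => mem_nbr.2 (hS w hw)) hcard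
  rw [this, mem_nbr]

theorem adj_iff_of_card_one [Fintype V] {G : SimpleGraph V} {v a : V} (ha : G.Adj v a)
    (hcard : (nbr G v).card = 1) (w : V) : G.Adj v w ↔ w = a := by
  rw [adj_iff_of_card_nbr {a} (by simpa using ha) (by simp [hcard]), Finset.mem_singleton]

theorem adj_iff_of_card_two [Fintype V] {G : SimpleGraph V} {v a b : V} (ha : G.Adj v a)
    (hb : G.Adj v b) (hab : a ≠ b) (hcard : (nbr G v).card = 2) (w : V) :
    G.Adj v w ↔ w = a ∨ w = b := by
  classical
  rw [adj_iff_of_card_nbr {a, b} (by simp [ha, hb]) (by rw [hcard, Finset.card_pair hab])]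
  simp

theorem adj_iff_of_card_three [Fintype V] {G : SimpleGraph V} {v a b c : V} (ha : G.Adj v a)
    (hb : G.Adj v b) (hc : G.Adj v c) (hab : a ≠ b) (hac : a ≠ c) (hbc : b ≠ c)
    (hcard : (nbr G v).card = 3) (w : V) : G.Adj v w ↔ w = a ∨ w = b ∨ w = c := by
  classical
  rw [adj_iff_of_card_nbr {a, b, c} (by simp [ha, hb, hc])
    (by rw [hcard, Finset.card_eq_three.2 ⟨a, b, c, hab, hac, hbc, rfl⟩])]
  simp

theorem ne_of_mem_edits {G H : SimpleGraph V} {a b : V} (h : s(a, b) ∈ edits G H) : a ≠ b := by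
  rintro rfl
  simp [mem_edits] at h

/-- Every solution changes one of the four relevant pairs of a walk of length three that does not
close up. -/
theorem exists_edit_of_walk {G H : SimpleGraph V} (hH : WalkClosed H) {a b c d : V}
    (hab : G.Adj a b) (hbc : G.Adj b c) (hcd : G.Adj c d) (had : ¬ G.Adj a d) :
    s(a, b) ∈ edits G H ∨ s(b, c) ∈ edits G H ∨ s(c, d) ∈ edits G H ∨ s(a, d) ∈ edits G H := by
  simp only [mem_edits]
  have := hH a b c d
  tauto

/-- `H'` is a bicluster graph at most as far from `G` as `H`. -/
def Improves (G H H' : SimpleGraph V) : Prop :=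
  WalkClosed H' ∧ (edits G H').ncard ≤ (edits G H).ncard

/-- At a path that starts in a vertex of degree one, an edge of the path may be removed. -/
theorem leaf_exchange [Fintype V] {G H : SimpleGraph V} (hH : WalkClosed H) {a b c d : V}
    (hab : G.Adj a b) (hbc : G.Adj b c) (hcd : G.Adj c d) (had : ¬ G.Adj a d)
    (hdeg : (nbr G a).card = 1) :
    ∃ H', Improves G H H' ∧
      (s(a, b) ∈ edits G H' ∨ s(b, c) ∈ edits G H' ∨ s(c, d) ∈ edits G H') := by
  rcases exists_edit_of_walk hH hab hbc hcd had with h | h | h | h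
  · exact ⟨H, ⟨hH, le_rfl⟩, Or.inl h⟩
  · exact ⟨H, ⟨hH, le_rfl⟩, Or.inr (Or.inl h)⟩
  · exact ⟨H, ⟨hH, le_rfl⟩, Or.inr (Or.inr h)⟩
  -- Here the solution edits `ad`. Isolating `a` costs only the edge `ab`, its sole edge, and saves
  -- the edit `ad`.
  · have hdis : Disjoint {a} (∅ : Set V) := Set.disjoint_empty _
    refine ⟨withBiclique H {a} ∅ hdis, ⟨hH.withBiclique hdis, ?_⟩, Or.inl ?_⟩
    · refine ncard_edits_withBiclique hdis {s(a, b)} {s(a, d)} ?_ (by simp) ?_ le_rfl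
      · rintro x rfl y hxy
        rw [adj_iff_of_card_one hab hdeg, Set.mem_empty_iff_false, iff_false, not_not] at hxy
        simp [hxy]
      · intro e he
        rw [Finset.mem_singleton] at he
        subst he
        exact ⟨h, a, by simp, by simp⟩
    · rw [mem_edits]
      simp [withBiclique, hab]

/-- At a path with three consecutive vertices of degree two that does not lie in a cycle of length
four, an edge of the path may be removed. -/
theorem path_exchange [Fintype V] {G H : SimpleGraph V} (hH : WalkClosed H) {a b c d y : V}
    (hab : G.Adj a b) (hbc : G.Adj b c) (hcd : G.Adj c d) (hdy : G.Adj d y)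
    (hac : a ≠ c) (hbd : b ≠ d) (hcy : c ≠ y) (hay : a ≠ y)
    (hb : (nbr G b).card = 2) (hc : (nbr G c).card = 2) (hd : (nbr G d).card = 2) :
    ∃ H', Improves G H H' ∧
      (s(a, b) ∈ edits G H' ∨ s(b, c) ∈ edits G H' ∨ s(c, d) ∈ edits G H') := by
  classical
  have nb := adj_iff_of_card_two hab.symm hbc hac hb
  have nc := adj_iff_of_card_two hbc.symm hcd hbd hc
  have nd := adj_iff_of_card_two hcd.symm hdy hcy hd
  have had : ¬ G.Adj a d := fun h => by
    rcases (nd a).1 h.symm with h | h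
    · exact hac h
    · exact hay h
  have hby : ¬ G.Adj b y := fun h => by
    rcases (nb y).1 h with h | h
    · exact hay h.symm
    · exact hcy h.symm
  by_cases h1 : s(a, b) ∈ edits G H
  · exact ⟨H, ⟨hH, le_rfl⟩, Or.inl h1⟩
  by_cases h2 : s(b, c) ∈ edits G H
  · exact ⟨H, ⟨hH, le_rfl⟩, Or.inr (Or.inl h2)⟩
  by_cases h3 : s(c, d) ∈ edits G H
  · exact ⟨H, ⟨hH, le_rfl⟩, Or.inr (Or.inr h3)⟩
  have h4 : s(a, d) ∈ edits G H := by
    simpa [h1, h2, h3] using exists_edit_of_walk hH hab hbc hcd had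
  -- The solution pays for `ad`. The open walk `b c d y` forces a second edit, and these two pay for
  -- cutting off the star with centre `c` and leaves `b`, `d`, whose only outgoing edges are `ab`
  -- and `dy`.
  obtain ⟨e, he, hne, hx⟩ : ∃ e ∈ edits G H, e ≠ s(a, d) ∧ ∃ x ∈ ({c} ∪ {b, d} : Set V), x ∈ e := by
    have h5 : s(d, y) ∈ edits G H ∨ s(b, y) ∈ edits G H := by
      simpa [h2, h3] using exists_edit_of_walk hH hbc hcd hdy hby
    rcases h5 with h5 | h5
    · refine ⟨_, h5, ?_, d, by simp, by simp⟩
      rw [Sym2.eq_swap, Ne, Sym2.congr_left]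
      exact hay.symm
    · refine ⟨_, h5, ?_, b, by simp, by simp⟩
      rw [Ne, Sym2.eq_iff]
      rintro (⟨h, -⟩ | ⟨h, -⟩)
      · exact hab.ne h.symm
      · exact hbd h
  have hdis : Disjoint {c} ({b, d} : Set V) := by
    rw [Set.disjoint_singleton_left]
    simp [hbc.ne', hcd.ne]
  refine ⟨withBiclique H {c} {b, d} hdis, ⟨hH.withBiclique hdis, ?_⟩, Or.inl ?_⟩
  · refine ncard_edits_withBiclique hdis {s(a, b), s(d, y)} {s(a, d), e} ?_ ?_ ?_ ?_
    · rintro x rfl z hxz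
      exact absurd (nc z) hxz
    · rintro x (rfl | rfl) z hxz
      · rw [nb, Set.mem_singleton_iff] at hxz
        have : z = a := by tauto
        simp [this]
      · rw [nd, Set.mem_singleton_iff] at hxz
        have : z = y := by tauto
        simp [this]
    · intro f hf
      rw [Finset.mem_insert, Finset.mem_singleton] at hf
      rcases hf with rfl | rfl
      · exact ⟨h4, d, by simp, by simp⟩
      · exact ⟨he, hx⟩
    · rw [Finset.card_pair hne.symm]
      exact Finset.card_le_two
  · rw [mem_edits]
    have := hab.ne
    have := ne_of_mem_edits h4
    simp [withBiclique, *]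

/-- A separate component that is a complete bipartite graph `K₃,₃` with one edge missing is best
completed. -/
theorem complete_one_exchange [Fintype V] {G H : SimpleGraph V} (hH : WalkClosed H)
    {u v w w' p z : V} (huv : u ≠ v) (huz : u ≠ z) (hvz : v ≠ z) (hww : w ≠ w') (hwp : w ≠ p)
    (hwp' : w' ≠ p) (hup : u ≠ p) (h1 : G.Adj u w) (h2 : G.Adj u w') (h3 : G.Adj v w)
    (h4 : G.Adj v w') (h5 : G.Adj v p) (h6 : G.Adj z p) (h7 : G.Adj z w') (h8 : G.Adj z w)
    (hu : (nbr G u).card = 2) (hv : (nbr G v).card = 3) (hw : (nbr G w).card = 3)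
    (hw' : (nbr G w').card = 3) (hp : (nbr G p).card = 2) (hz : (nbr G z).card = 3) :
    ∃ H', Improves G H H' ∧ s(u, p) ∈ edits G H' := by
  classical
  have nu := adj_iff_of_card_two h1 h2 hww hu
  have nv := adj_iff_of_card_three h3 h4 h5 hww hwp hwp' hv
  have nz := adj_iff_of_card_three h8 h7 h6 hww hwp hwp' hz
  have nw := adj_iff_of_card_three h1.symm h3.symm h8.symm huv huz hvz hw
  have nw' := adj_iff_of_card_three h2.symm h4.symm h7.symm huv huz hvz hw'
  have np := adj_iff_of_card_two h5.symm h6.symm hvz hp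
  have nup : ¬ G.Adj u p := fun h => by
    rcases (nu p).1 h with h | h
    · exact hwp h.symm
    · exact hwp' h.symm
  have hdis : Disjoint ({u, v, z} : Set V) {w, w', p} := by
    rw [Set.disjoint_left]
    simp only [Set.mem_insert_iff, Set.mem_singleton_iff]
    rintro x (rfl | rfl | rfl) (rfl | rfl | rfl) <;> simp_all
  refine ⟨withBiclique H {u, v, z} {w, w', p} hdis, ⟨hH.withBiclique hdis, ?_⟩, ?_⟩
  -- The walk `u w v p` is open, so every solution makes some edit in this component. The completion
  -- needs only one.
  · obtain ⟨e, he, hx⟩ : ∃ e ∈ edits G H, ∃ x ∈ ({u, v, z} ∪ {w, w', p} : Set V), x ∈ e := by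
      rcases exists_edit_of_walk hH h1 h3.symm h5 nup with h | h | h | h
      · exact ⟨_, h, u, by simp, by simp⟩
      · exact ⟨_, h, w, by simp, by simp⟩
      · exact ⟨_, h, v, by simp, by simp⟩
      · exact ⟨_, h, u, by simp, by simp⟩
    refine ncard_edits_withBiclique hdis {s(u, p)} {e} ?_ ?_ ?_ le_rfl
    · rintro x (rfl | rfl | rfl) y hxy
      · rw [nu, Set.mem_insert_iff, Set.mem_insert_iff, Set.mem_singleton_iff] at hxy
        have : y = p := by tauto
        simp [this]
      · exact absurd (nv y) hxy
      · exact absurd (nz y) hxy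
    · rintro x (rfl | rfl | rfl) y hxy
      · exact absurd (nw y) hxy
      · exact absurd (nw' y) hxy
      · rw [np, Set.mem_insert_iff, Set.mem_insert_iff, Set.mem_singleton_iff] at hxy
        have : y = u := by tauto
        simp [this]
    · intro f hf
      rw [Finset.mem_singleton] at hf
      rw [hf]
      exact ⟨he, hx⟩
  · rw [mem_edits]
    simp [withBiclique, nup]

/-- A separate component that is a complete bipartite graph `K₃,₃` with two disjoint edges missing
is best completed. -/
theorem complete_two_exchange [Fintype V] {G H : SimpleGraph V} (hH : WalkClosed H)
    {u v w w' p z : V} (huv : u ≠ v) (huz : u ≠ z) (hvz : v ≠ z) (hww : w ≠ w') (hwp : w ≠ p)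
    (hwp' : w' ≠ p) (hup : u ≠ p) (hwz : w ≠ z)
    (h1 : G.Adj u w) (h2 : G.Adj u w') (h3 : G.Adj v w)
    (h4 : G.Adj v w') (h5 : G.Adj v p) (h6 : G.Adj z p) (h7 : G.Adj z w')
    (hu : (nbr G u).card = 2) (hv : (nbr G v).card = 3) (hw : (nbr G w).card = 2)
    (hw' : (nbr G w').card = 3) (hp : (nbr G p).card = 2) (hz : (nbr G z).card = 2) :
    ∃ H', Improves G H H' ∧ s(u, p) ∈ edits G H' ∧ s(z, w) ∈ edits G H' := by
  classical
  have nu := adj_iff_of_card_two h1 h2 hww hu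
  have nv := adj_iff_of_card_three h3 h4 h5 hww hwp hwp' hv
  have nz := adj_iff_of_card_two h7 h6 hwp' hz
  have nw := adj_iff_of_card_two h1.symm h3.symm huv hw
  have nw' := adj_iff_of_card_three h2.symm h4.symm h7.symm huv huz hvz hw'
  have np := adj_iff_of_card_two h5.symm h6.symm hvz hp
  have nup : ¬ G.Adj u p := fun h => by
    rcases (nu p).1 h with h | h
    · exact hwp h.symm
    · exact hwp' h.symm
  have nwz : ¬ G.Adj w z := fun h => by
    rcases (nw z).1 h with h | h
    · exact huz h.symm
    · exact hvz h.symm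
  have hdis : Disjoint ({u, v, z} : Set V) {w, w', p} := by
    rw [Set.disjoint_left]
    simp only [Set.mem_insert_iff, Set.mem_singleton_iff]
    rintro x (rfl | rfl | rfl) (rfl | rfl | rfl) <;> simp_all
  refine ⟨withBiclique H {u, v, z} {w, w', p} hdis, ⟨hH.withBiclique hdis, ?_⟩, ?_, ?_⟩
  · obtain ⟨e, e', hne, he, he', hx, hx'⟩ : ∃ e e', e ≠ e' ∧ e ∈ edits G H ∧ e' ∈ edits G H ∧
        (∃ x ∈ ({u, v, z} ∪ {w, w', p} : Set V), x ∈ e) ∧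
        ∃ x ∈ ({u, v, z} ∪ {w, w', p} : Set V), x ∈ e' := by
      have key : ∀ {a b c d : V}, G.Adj a b → G.Adj b c → G.Adj c d → ¬ G.Adj a d →
          a ∈ ({u, v, z} ∪ {w, w', p} : Set V) → c ∈ ({u, v, z} ∪ {w, w', p} : Set V) →
          ∃ e ∈ edits G H, (∃ x ∈ ({u, v, z} ∪ {w, w', p} : Set V), x ∈ e) ∧
            (e = s(a, b) ∨ e = s(b, c) ∨ e = s(c, d) ∨ e = s(a, d)) := by
        intro a b c d hab hbc hcd had ha hc
        rcases exists_edit_of_walk hH hab hbc hcd had with h | h | h | h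
        · exact ⟨_, h, ⟨a, ha, by simp⟩, by simp⟩
        · exact ⟨_, h, ⟨c, hc, by simp⟩, by simp⟩
        · exact ⟨_, h, ⟨c, hc, by simp⟩, by simp⟩
        · exact ⟨_, h, ⟨a, ha, by simp⟩, by simp⟩
      obtain ⟨e₁, he₁, hx₁, h₁⟩ := key h1 h3.symm h5 nup (by simp) (by simp)
      obtain ⟨e₂, he₂, hx₂, h₂⟩ := key h2 h7.symm h6 nup (by simp) (by simp)
      obtain ⟨e₃, he₃, hx₃, h₃⟩ := key h1.symm h2 h7.symm nwz (by simp) (by simp)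
      -- Two different edits are needed. The pair `up` does not occur among the four pairs of the
      -- walk `w u w' z`. If `e₁` is another pair of `u w v p`, then it contains `w` or `v`, whereas
      -- the pairs of `u w' z p` avoid both.
      by_cases h : e₁ = s(u, p)
      · refine ⟨e₁, e₃, ?_, he₁, he₃, hx₁, hx₃⟩
        rw [h]
        rcases h₃ with rfl | rfl | rfl | rfl <;> rw [Ne, Sym2.eq_iff]
        · exact fun h => h.elim (fun h => h1.ne h.1) fun h => hwp h.2.symm
        · exact fun h => h.elim (fun h => hwp' h.2.symm) fun h => h2.ne h.1
        · exact fun h => h.elim (fun h => h2.ne h.1) fun h => huz h.1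
        · exact fun h => h.elim (fun h => h1.ne h.1) fun h => huz h.1
      · refine ⟨e₁, e₂, ?_, he₁, he₂, hx₁, hx₂⟩
        rintro rfl
        have hwv : w ∈ e₁ ∨ v ∈ e₁ := by
          rcases h₁ with rfl | rfl | rfl | h'
          exacts [Or.inl (by simp), Or.inl (by simp), Or.inr (by simp), absurd h' h]
        have hw : w ∉ e₁ := by
          rcases h₂ with rfl | rfl | rfl | h'
          exacts [by simp [h1.ne', hww], by simp [hww, hwz], by simp [hwz, hwp], absurd h' h]
        have hv : v ∉ e₁ := by
          rcases h₂ with rfl | rfl | rfl | h'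
          exacts [by simp [huv.symm, h4.ne], by simp [h4.ne, hvz], by simp [hvz, h5.ne],
            absurd h' h]
        exact hwv.elim hw hv
    refine ncard_edits_withBiclique hdis {s(u, p), s(z, w)} {e, e'} ?_ ?_ ?_ ?_
    · rintro x (rfl | rfl | rfl) y hxy
      · rw [nu, Set.mem_insert_iff, Set.mem_insert_iff, Set.mem_singleton_iff] at hxy
        have : y = p := by tauto
        simp [this]
      · exact absurd (nv y) hxy
      · rw [nz, Set.mem_insert_iff, Set.mem_insert_iff, Set.mem_singleton_iff] at hxy
        have : y = w := by tauto
        simp [this]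
    · rintro x (rfl | rfl | rfl) y hxy
      · rw [nw, Set.mem_insert_iff, Set.mem_insert_iff, Set.mem_singleton_iff] at hxy
        have : y = z := by tauto
        simp [this]
      · exact absurd (nw' y) hxy
      · rw [np, Set.mem_insert_iff, Set.mem_insert_iff, Set.mem_singleton_iff] at hxy
        have : y = u := by tauto
        simp [this]
    · intro f hf
      rw [Finset.mem_insert, Finset.mem_singleton] at hf
      rcases hf with rfl | rfl
      · exact ⟨he, hx⟩
      · exact ⟨he', hx'⟩
    · rw [Finset.card_pair hne]
      exact Finset.card_le_two
  · rw [mem_edits]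
    simp [withBiclique, nup]
  · rw [mem_edits]
    have : ¬ G.Adj z w := fun h => nwz h.symm
    simp [withBiclique, this]

end Bicluster


/-! ## Branching rules -/

namespace Bicluster

/-- A condition on six vertices of a graph. -/
inductive Lit
  | adj (i j : Fin 6)
  | nadj (i j : Fin 6)
  | ne (i j : Fin 6)
  | diff (i j l : Fin 6)
  | deg (i : Fin 6) (c : ℕ)

/-- The meaning of a condition. `diff i j l` says that exactly one of the vertices `i` and `j` is
adjacent to the vertex `l`, and `deg i c` that the vertex `i` has degree `c`. -/
def Lit.Holds {V : Type*} [Fintype V] (G : SimpleGraph V) (x : Fin 6 → V) : Lit → Prop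
  | .adj i j => G.Adj (x i) (x j)
  | .nadj i j => ¬ G.Adj (x i) (x j)
  | .ne i j => x i ≠ x j
  | .diff i j l => ¬ (G.Adj (x i) (x l) ↔ G.Adj (x j) (x l))
  | .deg i c => (nbr G (x i)).card = c

/-- A branch: a list of pairs to be edited, and a number that selects the branch. -/
structure Branch where
  code : ℕ
  pairs : List (Fin 6 × Fin 6)

/-- The pairs of vertices that a branch edits. -/
def Branch.edges {V : Type*} (b : Branch) (x : Fin 6 → V) : List (V × V) :=
  b.pairs.map fun e => (x e.1, x e.2)

/-- A branching rule: a pattern of conditions on six vertices, and the branches to be tried when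
the pattern occurs. -/
structure Rule where
  pattern : List Lit
  branches : List Branch

/-- The pattern of the rule occurs in `G` at the vertices `x`. -/
def Rule.Matches {V : Type*} [Fintype V] (ρ : Rule) (G : SimpleGraph V) (x : Fin 6 → V) : Prop :=
  ∀ l ∈ ρ.pattern, l.Holds G x

/-- Every branch consists of `m > 0` edits and is selected by `m` ternary digits, and no earlier
branch is selected by these digits. -/
def Rule.Decodable (ρ : Rule) : Prop :=
  (∀ b ∈ ρ.branches, 0 < b.pairs.length ∧ b.code < 3 ^ b.pairs.length) ∧
    ρ.branches.Pairwise fun a b =>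
      a.pairs.length ≤ b.pairs.length ∧ b.code % 3 ^ a.pairs.length ≠ a.code

/-- Wherever the pattern occurs, one of the branches is part of an optimal solution. -/
def Rule.Valid (ρ : Rule) : Prop :=
  ∀ (n : ℕ) (G H : SimpleGraph (Fin n)) (x : Fin 6 → Fin n), ρ.Matches G x → WalkClosed H →
    ∃ b ∈ ρ.branches, ∃ H', Improves G H H' ∧
      (∀ e ∈ b.edges x, s(e.1, e.2) ∈ edits G H') ∧ ((b.edges x).map fun e => s(e.1, e.2)).Nodup

/-- The branches that edit one pair each. -/
def singles (L : List (Fin 6 × Fin 6)) : List Branch := L.mapIdx fun q e => ⟨q, [e]⟩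

theorem Rule.valid_singles {P : List Lit} {L : List (Fin 6 × Fin 6)}
    (h : ∀ (n : ℕ) (G H : SimpleGraph (Fin n)) (x : Fin 6 → Fin n),
      Rule.Matches ⟨P, singles L⟩ G x → WalkClosed H →
      ∃ e ∈ L, ∃ H', Improves G H H' ∧ s(x e.1, x e.2) ∈ edits G H') :
    Rule.Valid ⟨P, singles L⟩ := by
  intro n G H x hm hH
  obtain ⟨e, he, H', hH', hed⟩ := h n G H x hm hH
  obtain ⟨q, hq, rfl⟩ := List.getElem_of_mem he
  refine ⟨⟨q, [L[q]]⟩, ?_, H', hH', ?_, ?_⟩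
  · exact List.mem_mapIdx.2 ⟨q, hq, rfl⟩
  · simpa [Branch.edges] using hed
  · simp [Branch.edges]

/-! ### Twin rules -/

/-- All ways to edit, for every vertex of a list, its adjacency to the vertex `0` or the
vertex `1`. -/
def choices : List (Fin 6) → List (List (Fin 6 × Fin 6))
  | [] => [[]]
  | i :: L => (choices L).flatMap fun c => [(0, i) :: c, (1, i) :: c]

/-- The branches given by `choices L`. -/
def choiceBranches (offset factor : ℕ) (L : List (Fin 6)) : List Branch :=
  (choices L).mapIdx fun q c => ⟨offset + factor * q, c⟩

theorem exists_choice {V : Type*} {G H : SimpleGraph V} {x : Fin 6 → V} :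
    ∀ {L : List (Fin 6)}, (∀ i ∈ L, s(x 0, x i) ∈ edits G H ∨ s(x 1, x i) ∈ edits G H) →
      ∃ c ∈ choices L, (∀ e ∈ c, s(x e.1, x e.2) ∈ edits G H) ∧
        (∀ e ∈ c, e.1 = 0 ∨ e.1 = 1) ∧ c.map Prod.snd = L
  | [], _ => ⟨[], by simp [choices]⟩
  | i :: L, h => by
    obtain ⟨c, hc, h1, h2, h3⟩ := exists_choice fun j hj => h j (List.mem_cons_of_mem _ hj)
    rcases h i List.mem_cons_self with hi | hi
    · refine ⟨(0, i) :: c, List.mem_flatMap.2 ⟨c, hc, by simp⟩, ?_, ?_, by simp [h3]⟩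
      · rintro e he
        rcases List.mem_cons.1 he with rfl | he
        exacts [hi, h1 e he]
      · rintro e he
        rcases List.mem_cons.1 he with rfl | he
        exacts [Or.inl rfl, h2 e he]
    · refine ⟨(1, i) :: c, List.mem_flatMap.2 ⟨c, hc, by simp⟩, ?_, ?_, by simp [h3]⟩
      · rintro e he
        rcases List.mem_cons.1 he with rfl | he
        exacts [hi, h1 e he]
      · rintro e he
        rcases List.mem_cons.1 he with rfl | he
        exacts [Or.inr rfl, h2 e he]

/-- The rule for two non-adjacent vertices `0` and `1` that have the common neighbours `W` and are
distinguished by the vertices `D`. -/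
def twinRule (W D : List (Fin 6)) (branches : List Branch) : Rule where
  pattern := .nadj 0 1 :: (W.flatMap fun i => [.adj 0 i, .adj 1 i]) ++
    (D.map fun i => .diff 0 1 i) ++
    (W.flatMap fun i => (W.filter (i ≠ ·)).map fun j => .ne i j) ++
    (D.flatMap fun i => (D.filter (i ≠ ·)).map fun j => .ne i j)
  branches := branches

theorem twinRule_matches {V : Type*} [Fintype V] {W D : List (Fin 6)} {branches : List Branch}
    {G : SimpleGraph V} {x : Fin 6 → V} :
    (twinRule W D branches).Matches G x ↔ ¬ G.Adj (x 0) (x 1) ∧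
      (∀ i ∈ W, G.Adj (x 0) (x i) ∧ G.Adj (x 1) (x i)) ∧
      (∀ i ∈ D, ¬ (G.Adj (x 0) (x i) ↔ G.Adj (x 1) (x i))) ∧
      (∀ i ∈ W, ∀ j ∈ W, i ≠ j → x i ≠ x j) ∧ ∀ i ∈ D, ∀ j ∈ D, i ≠ j → x i ≠ x j := by
  simp only [Rule.Matches, twinRule, List.cons_append, List.forall_mem_cons, List.append_assoc,
    List.forall_mem_append, List.mem_flatMap, List.mem_map, List.mem_filter, Lit.Holds,
    forall_exists_index, and_imp, forall_apply_eq_imp_iff₂, decide_eq_true_eq]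
  refine and_congr_right fun _ => and_congr ?_ (and_congr_right fun _ => and_congr ?_ ?_)
  · exact ⟨fun h i hi => ⟨h (.adj 0 i) i hi (by simp), h (.adj 1 i) i hi (by simp)⟩, fun h l i hi hl => by
      rcases List.mem_pair.1 hl with rfl | rfl
      exacts [(h i hi).1, (h i hi).2]⟩
  · exact ⟨fun h i hi j hj hij => h _ i hi j hj hij rfl, fun h l i hi j hj hij hl => by
      subst hl
      exact h i hi j hj hij⟩
  · exact ⟨fun h i hi j hj hij => h _ i hi j hj hij rfl, fun h l i hi j hj hij hl => by
      subst hl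
      exact h i hi j hj hij⟩

/-- The pairs of a choice have distinct second vertices, none of which is `x 0` or `x 1`. Hence they
are distinct even as unordered pairs, as `ncard_edits_toggleList` requires. -/
theorem exists_choice_branch {V : Type*} {G H : SimpleGraph V} {x : Fin 6 → V}
    {L : List (Fin 6)} (hL : L.Nodup)
    (hed : ∀ i ∈ L, s(x 0, x i) ∈ edits G H ∨ s(x 1, x i) ∈ edits G H)
    (hne : ∀ i ∈ L, x i ≠ x 0 ∧ x i ≠ x 1) (hinj : ∀ i ∈ L, ∀ j ∈ L, i ≠ j → x i ≠ x j) :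
    ∃ c ∈ choices L, ∀ b : Branch, b.pairs = c → (∀ e ∈ b.edges x, s(e.1, e.2) ∈ edits G H) ∧
      ((b.edges x).map fun e => s(e.1, e.2)).Nodup := by
  obtain ⟨c, hc, h1, h2, h3⟩ := exists_choice hed
  refine ⟨c, hc, ?_⟩
  rintro b rfl
  refine ⟨fun e he => ?_, ?_⟩
  · obtain ⟨f, hf, rfl⟩ := List.mem_map.1 he
    exact h1 f hf
  rw [Branch.edges, List.map_map]
  have hnd : (b.pairs.map Prod.snd).Nodup := h3 ▸ hL
  refine List.Nodup.map_on ?_ (List.Nodup.of_map _ hnd)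
  intro e he f hf hef
  have heL : e.2 ∈ L := h3 ▸ List.mem_map_of_mem he
  have hfL : f.2 ∈ L := h3 ▸ List.mem_map_of_mem hf
  refine List.inj_on_of_nodup_map hnd he hf ?_
  by_contra hne'
  rcases Sym2.eq_iff.1 hef with h | h
  · exact hinj _ heL _ hfL hne' h.2
  · rcases h2 f hf with h' | h'
    · exact (hne _ heL).1 (h.2.trans (congrArg x h'))
    · exact (hne _ heL).2 (h.2.trans (congrArg x h'))

/-- If some vertex of `W` remains a common neighbour in `H`, then `x 0` and `x 1` are twins in `H`,
and every vertex of `D` must be edited at one of them. Otherwise every vertex of `W` loses one of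
its two edges. -/
theorem twinRule_valid {W D : List (Fin 6)} {branches : List Branch} (hW : W.Nodup) (hD : D.Nodup)
    (hb : ∀ c ∈ choices W ++ choices D, ∃ b ∈ branches, b.pairs = c) :
    (twinRule W D branches).Valid := by
  intro n G H x hm hH
  obtain ⟨h01, hadj, hdiff, hinjW, hinjD⟩ := twinRule_matches.1 hm
  suffices ∃ c ∈ choices W ++ choices D, ∀ b : Branch, b.pairs = c →
      (∀ e ∈ b.edges x, s(e.1, e.2) ∈ edits G H) ∧
        ((b.edges x).map fun e => s(e.1, e.2)).Nodup by
    obtain ⟨c, hc, h⟩ := this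
    obtain ⟨b, hbm, hbc⟩ := hb c hc
    exact ⟨b, hbm, H, ⟨hH, le_rfl⟩, h b hbc⟩
  by_cases hex : ∃ i ∈ W, H.Adj (x 0) (x i) ∧ H.Adj (x 1) (x i)
  · obtain ⟨i, -, hi0, hi1⟩ := hex
    have htwin : ∀ y, H.Adj (x 0) y ↔ H.Adj (x 1) y := fun y =>
      ⟨fun h => hH _ _ _ _ hi1 hi0.symm h, fun h => hH _ _ _ _ hi0 hi1.symm h⟩
    obtain ⟨c, hc, h⟩ := exists_choice_branch (G := G) (H := H) (x := x) hD (fun j hj => by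
      have h1 := hdiff j hj
      have h2 := htwin (x j)
      rw [mem_edits, mem_edits]
      tauto) (fun j hj => by
      have h1 := hdiff j hj
      constructor
      · intro h
        rw [h] at h1
        exact h1 (iff_of_false G.irrefl fun h => h01 h.symm)
      · intro h
        rw [h] at h1
        exact h1 (iff_of_false h01 G.irrefl)) hinjD
    exact ⟨c, List.mem_append_right _ hc, h⟩
  · obtain ⟨c, hc, h⟩ := exists_choice_branch (G := G) (H := H) (x := x) hW (fun j hj => by
      have h1 := hadj j hj
      have h2 : ¬ (H.Adj (x 0) (x j) ∧ H.Adj (x 1) (x j)) := fun h => hex ⟨j, hj, h⟩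
      rw [mem_edits, mem_edits]
      tauto) (fun j hj => ⟨(hadj j hj).1.ne', (hadj j hj).2.ne'⟩) hinjW
    exact ⟨c, List.mem_append_left _ hc, h⟩

/-- The list of all branching rules. -/
def rules : List Rule :=
  [⟨[.adj 0 1, .adj 1 2, .adj 2 0], singles [(0, 1), (1, 2), (2, 0)]⟩,
   ⟨[.adj 0 1, .adj 1 2, .adj 2 3, .nadj 0 3, .deg 0 1], singles [(0, 1), (1, 2), (2, 3)]⟩,
   ⟨[.adj 0 1, .adj 1 2, .adj 2 3, .adj 3 4, .ne 0 2, .ne 1 3, .ne 2 4, .ne 0 4,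
      .deg 1 2, .deg 2 2, .deg 3 2], singles [(0, 1), (1, 2), (2, 3)]⟩,
   -- The two short branches take the last digits 0 and 1; the eight long ones take the codes `2 + 3
   -- * q` with `q < 8`, whose last digit is 2.
   twinRule [2] [3, 4, 5] (choiceBranches 0 1 [2] ++ choiceBranches 2 3 [3, 4, 5]),
   twinRule [2, 3] [4, 5] (choiceBranches 0 1 [2, 3] ++ choiceBranches 4 1 [4, 5]),
   -- Here position 2 is the distinguishing vertex, which keeps the shorter branches first, as
   -- `Rule.Decodable` demands.
   twinRule [3, 4, 5] [2] (choiceBranches 0 1 [2] ++ choiceBranches 2 3 [3, 4, 5]),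
   -- In the last two rules the positions 0, …, 5 are `u`, `v`, `w`, `w'`, `p`, `z` of
   -- `complete_one_exchange` and `complete_two_exchange`.
   ⟨[.ne 0 1, .ne 0 5, .ne 1 5, .ne 2 3, .ne 2 4, .ne 3 4, .ne 0 4, .adj 0 2, .adj 0 3, .adj 1 2,
      .adj 1 3, .adj 1 4, .adj 5 4, .adj 5 3, .adj 5 2, .deg 0 2, .deg 1 3, .deg 2 3, .deg 3 3,
      .deg 4 2, .deg 5 3], [⟨0, [(0, 4)]⟩]⟩,
   ⟨[.ne 0 1, .ne 0 5, .ne 1 5, .ne 2 3, .ne 2 4, .ne 3 4, .ne 0 4, .ne 2 5, .adj 0 2, .adj 0 3,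
      .adj 1 2, .adj 1 3, .adj 1 4, .adj 5 4, .adj 5 3, .deg 0 2, .deg 1 3, .deg 2 2, .deg 3 3,
      .deg 4 2, .deg 5 2], [⟨0, [(0, 4), (5, 2)]⟩]⟩]

theorem rules_decodable : ∀ ρ ∈ rules, ρ.Decodable := by
  simp only [rules, List.mem_cons, List.not_mem_nil, or_false, forall_eq_or_imp, forall_eq,
    Rule.Decodable]
  decide

theorem rules_valid : ∀ ρ ∈ rules, ρ.Valid := by
  simp only [rules, List.mem_cons, List.not_mem_nil, or_false, forall_eq_or_imp, forall_eq]
  refine ⟨?_, ?_, ?_, ?_, ?_, ?_, ?_, ?_⟩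
  · refine Rule.valid_singles fun n G H x hm hH => ?_
    simp [Rule.Matches, Lit.Holds] at hm
    obtain ⟨h1, h2, h3⟩ := hm
    rcases exists_edit_of_walk hH h1 h2 h3 G.irrefl with h | h | h | h
    · exact ⟨(0, 1), by simp, H, ⟨hH, le_rfl⟩, h⟩
    · exact ⟨(1, 2), by simp, H, ⟨hH, le_rfl⟩, h⟩
    · exact ⟨(2, 0), by simp, H, ⟨hH, le_rfl⟩, h⟩
    · exact absurd rfl (ne_of_mem_edits h)
  · refine Rule.valid_singles fun n G H x hm hH => ?_
    simp [Rule.Matches, Lit.Holds] at hm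
    obtain ⟨h1, h2, h3, h4, h5⟩ := hm
    obtain ⟨H', hH', h⟩ := leaf_exchange hH h1 h2 h3 h4 h5
    rcases h with h | h | h
    · exact ⟨(0, 1), by simp, H', hH', h⟩
    · exact ⟨(1, 2), by simp, H', hH', h⟩
    · exact ⟨(2, 3), by simp, H', hH', h⟩
  · refine Rule.valid_singles fun n G H x hm hH => ?_
    simp [Rule.Matches, Lit.Holds] at hm
    obtain ⟨h1, h2, h3, h4, h5, h6, h7, h8, h9, h10, h11⟩ := hm
    obtain ⟨H', hH', h⟩ := path_exchange hH h1 h2 h3 h4 h5 h6 h7 h8 h9 h10 h11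
    rcases h with h | h | h
    · exact ⟨(0, 1), by simp, H', hH', h⟩
    · exact ⟨(1, 2), by simp, H', hH', h⟩
    · exact ⟨(2, 3), by simp, H', hH', h⟩
  · exact twinRule_valid (by decide) (by decide) (by decide)
  · exact twinRule_valid (by decide) (by decide) (by decide)
  · exact twinRule_valid (by decide) (by decide) (by decide)
  · intro n G H x hm hH
    simp [Rule.Matches, Lit.Holds] at hm
    obtain ⟨a1, a2, a3, a4, a5, a6, a7, h1, h2, h3, h4, h5, h6, h7, h8, d⟩ := hm
    obtain ⟨d1, d2, d3, d4, d5, d6⟩ := d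
    obtain ⟨H', hH', h⟩ := complete_one_exchange hH a1 a2 a3 a4 a5 a6 a7 h1 h2 h3 h4 h5 h6 h7 h8
      d1 d2 d3 d4 d5 d6
    exact ⟨_, List.mem_singleton_self _, H', hH', by simpa [Branch.edges], by simp [Branch.edges]⟩
  · intro n G H x hm hH
    simp [Rule.Matches, Lit.Holds] at hm
    obtain ⟨a1, a2, a3, a4, a5, a6, a7, a8, h1, h2, h3, h4, h5, h6, h7, d⟩ := hm
    obtain ⟨d1, d2, d3, d4, d5, d6⟩ := d
    obtain ⟨H', hH', h, h'⟩ := complete_two_exchange hH a1 a2 a3 a4 a5 a6 a7 a8 h1 h2 h3 h4 h5 h6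
      h7 d1 d2 d3 d4 d5 d6
    refine ⟨_, List.mem_singleton_self _, H', hH', by simpa [Branch.edges] using ⟨h, h'⟩, ?_⟩
    simp [Branch.edges, a2, h1.ne]

end Bicluster


/-! ## Graphs to which no branching rule applies -/

namespace Bicluster

variable {V : Type*} [Fintype V] {G : SimpleGraph V}

/-- No branching rule applies to the graph. -/
def Irreducible (G : SimpleGraph V) : Prop := ∀ ρ ∈ rules, ∀ x, ¬ ρ.Matches G x

theorem Irreducible.not_triangle (hG : Irreducible G) {a b c : V} (hab : G.Adj a b)
    (hbc : G.Adj b c) : ¬ G.Adj c a := fun hca =>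
  hG rules[0] (by simp [rules]) ![a, b, c, a, a, a]
    (by simp [rules, Rule.Matches, Lit.Holds, *])

theorem Irreducible.two_le_card_nbr (hG : Irreducible G) {a b c d : V} (hab : G.Adj a b)
    (hbc : G.Adj b c) (hcd : G.Adj c d) (had : ¬ G.Adj a d) : 2 ≤ (nbr G a).card := by
  have h0 : 0 < (nbr G a).card := Finset.card_pos.2 ⟨b, mem_nbr.2 hab⟩
  have h1 : (nbr G a).card ≠ 1 := fun h =>
    hG rules[1] (by simp [rules]) ![a, b, c, d, a, a]
      (by simp [rules, Rule.Matches, Lit.Holds, *])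
  omega

theorem Irreducible.not_path (hG : Irreducible G) {a b c d y : V}
    (hab : G.Adj a b) (hbc : G.Adj b c) (hcd : G.Adj c d) (hdy : G.Adj d y)
    (hac : a ≠ c) (hbd : b ≠ d) (hcy : c ≠ y) (hay : a ≠ y)
    (hb : (nbr G b).card = 2) (hc : (nbr G c).card = 2) (hd : (nbr G d).card = 2) : False :=
  hG rules[2] (by simp [rules]) ![a, b, c, d, y, a]
    (by simp [rules, Rule.Matches, Lit.Holds, *])

theorem Irreducible.not_complete_one (hG : Irreducible G)
    {u v w w' p z : V} (huv : u ≠ v) (huz : u ≠ z) (hvz : v ≠ z) (hww : w ≠ w') (hwp : w ≠ p)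
    (hwp' : w' ≠ p) (hup : u ≠ p) (h1 : G.Adj u w) (h2 : G.Adj u w') (h3 : G.Adj v w)
    (h4 : G.Adj v w') (h5 : G.Adj v p) (h6 : G.Adj z p) (h7 : G.Adj z w') (h8 : G.Adj z w)
    (hu : (nbr G u).card = 2) (hv : (nbr G v).card = 3) (hw : (nbr G w).card = 3)
    (hw' : (nbr G w').card = 3) (hp : (nbr G p).card = 2) (hz : (nbr G z).card = 3) : False :=
  hG rules[6] (by simp [rules]) ![u, v, w, w', p, z]
    (by simp [rules, Rule.Matches, Lit.Holds, *])

theorem Irreducible.not_complete_two (hG : Irreducible G)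
    {u v w w' p z : V} (huv : u ≠ v) (huz : u ≠ z) (hvz : v ≠ z) (hww : w ≠ w') (hwp : w ≠ p)
    (hwp' : w' ≠ p) (hup : u ≠ p) (hwz : w ≠ z)
    (h1 : G.Adj u w) (h2 : G.Adj u w') (h3 : G.Adj v w)
    (h4 : G.Adj v w') (h5 : G.Adj v p) (h6 : G.Adj z p) (h7 : G.Adj z w')
    (hu : (nbr G u).card = 2) (hv : (nbr G v).card = 3) (hw : (nbr G w).card = 2)
    (hw' : (nbr G w').card = 3) (hp : (nbr G p).card = 2) (hz : (nbr G z).card = 2) : False :=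
  hG rules[7] (by simp [rules]) ![u, v, w, w', p, z]
    (by simp [rules, Rule.Matches, Lit.Holds, *])

/-! ### Counting common and distinguishing neighbours -/

open Classical in
/-- The common neighbours of two vertices. -/
noncomputable def common (G : SimpleGraph V) (u v : V) : Finset V := nbr G u ∩ nbr G v

open Classical in
/-- The vertices adjacent to exactly one of two vertices. -/
noncomputable def differing (G : SimpleGraph V) (u v : V) : Finset V :=
  (nbr G u \ nbr G v) ∪ (nbr G v \ nbr G u)

theorem mem_common {u v w : V} : w ∈ common G u v ↔ G.Adj u w ∧ G.Adj v w := by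
  simp [common, mem_nbr]

theorem mem_differing {u v w : V} : w ∈ differing G u v ↔ ¬ (G.Adj u w ↔ G.Adj v w) := by
  simp only [differing, Finset.mem_union, Finset.mem_sdiff, mem_nbr]
  tauto

theorem card_nbr_add_card_nbr (u v : V) : (nbr G u).card + (nbr G v).card =
    2 * (common G u v).card + (differing G u v).card := by
  classical
  have h1 := Finset.card_sdiff_add_card_inter (nbr G u) (nbr G v)
  have h2 := Finset.card_sdiff_add_card_inter (nbr G v) (nbr G u)
  rw [Finset.inter_comm] at h2
  rw [differing, common, Finset.card_union_of_disjoint]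
  · omega
  · rw [Finset.disjoint_left]
    intro x hx hx'
    exact (Finset.mem_sdiff.1 hx').2 (Finset.mem_sdiff.1 hx).1

/-- This and the next two lemmas express the twin rules as counts. If both counts are positive, only
one common and one or two distinguishing vertices, or two common and one distinguishing vertex,
remain possible. -/
theorem Irreducible.not_twin_one_three (hG : Irreducible G) {u v : V} (huv : ¬ G.Adj u v)
    (hC : 1 ≤ (common G u v).card) : (differing G u v).card < 3 := by
  classical
  by_contra! hD
  obtain ⟨w, hw⟩ := Finset.card_pos.1 hC
  obtain ⟨D, hDs, hDc⟩ := Finset.exists_subset_card_eq hD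
  obtain ⟨d₁, d₂, d₃, h12, h13, h23, rfl⟩ := Finset.card_eq_three.1 hDc
  simp only [Finset.insert_subset_iff, Finset.singleton_subset_iff, mem_differing] at hDs
  rw [mem_common] at hw
  refine hG rules[3] (by simp [rules]) ![u, v, w, d₁, d₂, d₃] (twinRule_matches.2 ?_)
  simp [*, h12.symm, h13.symm, h23.symm]

theorem Irreducible.not_twin_two_two (hG : Irreducible G) {u v : V} (huv : ¬ G.Adj u v)
    (hC : 2 ≤ (common G u v).card) : (differing G u v).card < 2 := by
  classical
  by_contra! hD
  obtain ⟨C, hCs, hCc⟩ := Finset.exists_subset_card_eq hC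
  obtain ⟨w₁, w₂, hw, rfl⟩ := Finset.card_eq_two.1 hCc
  obtain ⟨D, hDs, hDc⟩ := Finset.exists_subset_card_eq hD
  obtain ⟨d₁, d₂, hd, rfl⟩ := Finset.card_eq_two.1 hDc
  simp only [Finset.insert_subset_iff, Finset.singleton_subset_iff, mem_differing] at hDs
  simp only [Finset.insert_subset_iff, Finset.singleton_subset_iff, mem_common] at hCs
  refine hG rules[4] (by simp [rules]) ![u, v, w₁, w₂, d₁, d₂] (twinRule_matches.2 ?_)
  simp [*, hw.symm, hd.symm]

theorem Irreducible.not_twin_three_one (hG : Irreducible G) {u v : V} (huv : ¬ G.Adj u v)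
    (hC : 3 ≤ (common G u v).card) : (differing G u v).card < 1 := by
  classical
  by_contra! hD
  obtain ⟨d, hd⟩ := Finset.card_pos.1 hD
  obtain ⟨C, hCs, hCc⟩ := Finset.exists_subset_card_eq hC
  obtain ⟨w₁, w₂, w₃, h12, h13, h23, rfl⟩ := Finset.card_eq_three.1 hCc
  simp only [Finset.insert_subset_iff, Finset.singleton_subset_iff, mem_common] at hCs
  rw [mem_differing] at hd
  refine hG rules[5] (by simp [rules]) ![u, v, d, w₁, w₂, w₃] (twinRule_matches.2 ?_)
  simp [*, h12.symm, h13.symm, h23.symm]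

/-- In an irreducible graph, a walk of length three that does not close up starts with a vertex of
degree two, and the third vertex has degree two or three. -/
theorem Irreducible.walk_cases (hG : Irreducible G) {a b c d : V} (hab : G.Adj a b)
    (hbc : G.Adj b c) (hcd : G.Adj c d) (had : ¬ G.Adj a d) : (nbr G a).card = 2 ∧
    ∃ b', b' ≠ b ∧ b' ≠ d ∧ G.Adj a b' ∧
      (((nbr G c).card = 2 ∧ ¬ G.Adj c b') ∨ ((nbr G c).card = 3 ∧ G.Adj c b')) := by
  have hbd : b ≠ d := fun h => had (h ▸ hab)
  have hac : ¬ G.Adj a c := fun h => hG.not_triangle hab hbc h.symm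
  have hbC : b ∈ common G a c := mem_common.2 ⟨hab, hbc.symm⟩
  have hdD : d ∈ differing G a c := mem_differing.2 fun h => had (h.2 hcd)
  have hC : 1 ≤ (common G a c).card := Finset.card_pos.2 ⟨b, hbC⟩
  have hD : 1 ≤ (differing G a c).card := Finset.card_pos.2 ⟨d, hdD⟩
  have h13 := hG.not_twin_one_three hac
  have h22 := hG.not_twin_two_two hac
  have h31 := hG.not_twin_three_one hac
  have hsum := card_nbr_add_card_nbr (G := G) a c
  have ha := hG.two_le_card_nbr hab hbc hcd had
  have hc : 2 ≤ (nbr G c).card := Finset.one_lt_card.2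
    ⟨b, mem_nbr.2 hbc.symm, d, mem_nbr.2 hcd, hbd⟩
  obtain ⟨b', hb', hbb'⟩ := Finset.exists_mem_ne (by omega : 1 < (nbr G a).card) b
  rw [mem_nbr] at hb'
  have hbd' : b' ≠ d := fun h => had (h ▸ hb')
  -- Here `deg a + deg c = 2 * |common| + |differing|`. With two common neighbours the sum is 5 and
  -- `deg c ≥ 3`; with one it is at most 4. As both degrees are at least 2, they are determined.
  by_cases hC2 : 2 ≤ (common G a c).card
  · have hD1 : (differing G a c).card = 1 := by have := h22 hC2; omega
    have hcb' : G.Adj c b' := by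
      by_contra hcb'
      have : b' ∈ differing G a c := mem_differing.2 fun h => hcb' (h.1 hb')
      exact hbd' (Finset.card_le_one.1 hD1.le _ this _ hdD)
    have hc3 : 3 ≤ (nbr G c).card := Finset.two_lt_card.2
      ⟨b, mem_nbr.2 hbc.symm, b', mem_nbr.2 hcb', d, mem_nbr.2 hcd, hbb'.symm, hbd, hbd'⟩
    exact ⟨by omega, b', hbb', hbd', hb', Or.inr ⟨by omega, hcb'⟩⟩
  · have hcb' : ¬ G.Adj c b' := fun h => hC2 (Finset.one_lt_card.2
      ⟨b, hbC, b', mem_common.2 ⟨hb', h⟩, hbb'.symm⟩)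
    have := h13 hC
    exact ⟨by omega, b', hbb', hbd', hb', Or.inl ⟨by omega, hcb'⟩⟩

/-- In an irreducible graph, there is no vertex of degree two whose neighbourhood is contained in
the neighbourhood of a vertex of degree three, provided that the latter satisfies some further
conditions. -/
theorem Irreducible.not_square_of_adj (hG : Irreducible G) {u v w w' p z : V}
    (hu : (nbr G u).card = 2) (hv : (nbr G v).card = 3) (h1 : G.Adj u w) (h2 : G.Adj u w')
    (h3 : G.Adj v w) (h4 : G.Adj v w') (h5 : G.Adj v p) (hww : w ≠ w') (hwp : w ≠ p)
    (hwp' : w' ≠ p) (hup : ¬ G.Adj u p) (hp : (nbr G p).card = 2) (hvz : v ≠ z)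
    (h6 : G.Adj z p) (h7 : G.Adj z w') (hw' : (nbr G w').card = 3)
    (hw : (nbr G w).card = 2 ∨ (nbr G w).card = 3 ∧ G.Adj w z) : False := by
  classical
  have huv : u ≠ v := fun h => by rw [h, hv] at hu; omega
  have huz : u ≠ z := fun h => hup (h ▸ h6)
  have hup' : u ≠ p := fun h => hG.not_triangle h3 h1.symm (h ▸ h5.symm)
  have hwz : w ≠ z := fun h => hG.not_triangle h2 h7.symm (h ▸ h1.symm)
  have nvz : ¬ G.Adj v z := hG.not_triangle h6 h5.symm
  -- If `z` is adjacent to `w`, then `v` and `z` have three common neighbours and are twins, and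
  -- only the edge `up` is missing from `K₃,₃`. Otherwise `wz` is missing as well, and the open walk
  -- `z p v w` gives `deg z = 2`.
  by_cases h8 : G.Adj z w
  · have hw3 : (nbr G w).card = 3 := And.left <| hw.resolve_left fun hw2 => by
      have := adj_iff_of_card_two h1.symm h3.symm huv hw2 z
      rcases this.1 h8.symm with h | h
      exacts [huz h.symm, hvz h.symm]
    have hC : 3 ≤ (common G v z).card := Finset.two_lt_card.2 ⟨w, mem_common.2 ⟨h3, h8⟩, w',
      mem_common.2 ⟨h4, h7⟩, p, mem_common.2 ⟨h5, h6⟩, hww, hwp, hwp'⟩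
    have hD := hG.not_twin_three_one nvz hC
    have hN : nbr G z = nbr G v := by
      ext y
      rw [mem_nbr, mem_nbr]
      by_contra h
      have : y ∈ differing G v z := mem_differing.2 fun h' => h h'.symm
      have := Finset.card_pos.2 ⟨y, this⟩
      omega
    exact hG.not_complete_one huv huz hvz hww hwp hwp' hup' h1 h2 h3 h4 h5 h6 h7 h8 hu hv hw3 hw'
      hp (hN ▸ hv)
  · obtain ⟨hz, -⟩ := hG.walk_cases h6 h5.symm h3 h8
    have hw2 : (nbr G w).card = 2 := hw.resolve_right fun hw3 => h8 hw3.2.symm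
    exact hG.not_complete_two huv huz hvz hww hwp hwp' hup' hwz h1 h2 h3 h4 h5 h6 h7 hu hv hw2 hw'
      hp hz

/-- In an irreducible graph, there is no vertex of degree two whose neighbourhood is contained in
the neighbourhood of a vertex of degree three. -/
theorem Irreducible.not_square (hG : Irreducible G) {u v w w' p : V}
    (hu : (nbr G u).card = 2) (hv : (nbr G v).card = 3) (h1 : G.Adj u w) (h2 : G.Adj u w')
    (h3 : G.Adj v w) (h4 : G.Adj v w') (h5 : G.Adj v p) (hww : w ≠ w') (hwp : w ≠ p)
    (hwp' : w' ≠ p) (hup : ¬ G.Adj u p) : False := by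
  have hpu : ¬ G.Adj p u := fun h => hup h.symm
  -- The open walks `p v w u` and `p v w' u` both start at `p`. Since `deg p = 2`, they yield the
  -- same second neighbour `z`.
  obtain ⟨hp, z, hzv, hzu, hpz, hw⟩ := hG.walk_cases h5.symm h3 h1.symm hpu
  obtain ⟨-, z', hzv', hzu', hpz', hw'⟩ := hG.walk_cases h5.symm h4 h2.symm hpu
  obtain rfl : z = z' := by
    rcases (adj_iff_of_card_two h5.symm hpz hzv.symm hp z').1 hpz' with h | h
    exacts [absurd h hzv', h.symm]
  rcases hw' with ⟨hw'2, nw'z⟩ | ⟨hw'3, hw'z⟩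
  · rcases hw with ⟨hw2, nwz⟩ | ⟨hw3, hwz⟩
    -- If `z` is adjacent to neither `w` nor `w'`, then the open walk `z p v w` requires a second
    -- neighbour of `z` among the neighbours of `v`, and none is left.
    · obtain ⟨-, y, hyp, hyw, hzy, h | ⟨-, hvy⟩⟩ :=
        hG.walk_cases hpz.symm h5.symm h3 fun h => nwz h.symm
      · omega
      · rcases (adj_iff_of_card_three h3 h4 h5 hww hwp hwp' hv y).1 hvy with rfl | rfl | rfl
        exacts [hyw rfl, nw'z hzy.symm, hyp rfl]
    · exact hG.not_square_of_adj hu hv h2 h1 h4 h3 h5 hww.symm hwp' hwp hup hp hzv.symm hpz.symm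
        hwz.symm hw3 (Or.inl hw'2)
  · exact hG.not_square_of_adj hu hv h1 h2 h3 h4 h5 hww hwp hwp' hup hp hzv.symm hpz.symm
      hw'z.symm hw'3 (hw.imp And.left id)

/-- Let `p` be the second neighbour of `a`. If `deg c = 3`, then `N(a) = {b, p}` lies in `N(c)`,
which `not_square` excludes. If `deg c = 2`, then `p a b c` is open too: for `deg b = 2` the path `p
a b c d` contradicts the path rule, and for `deg b = 3` the neighbourhood of `p` lies in that of
`b`. -/
theorem Irreducible.walkClosed (hG : Irreducible G) : WalkClosed G := by
  intro a b c d hab hbc hcd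
  by_contra had
  have hbd : b ≠ d := fun h => had (h ▸ hab)
  have hac : a ≠ c := fun h => had (h ▸ hcd)
  obtain ⟨ha, p, hpb, hpd, hap, ⟨hc, ncp⟩ | ⟨hc, hcp⟩⟩ := hG.walk_cases hab hbc hcd had
  · obtain ⟨-, y, hya, hyc, hpy, ⟨hb, -⟩ | ⟨hb, hby⟩⟩ :=
      hG.walk_cases hap.symm hab hbc fun h => ncp h.symm
    · exact hG.not_path hap.symm hab hbc hcd hpb hac hbd hpd ha hb hc
    · have hp := (hG.walk_cases hap.symm hab hbc fun h => ncp h.symm).1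
      exact hG.not_square hp hb hap.symm hpy hab.symm hby hbc hya.symm hac hyc
        fun h => ncp h.symm
  · exact hG.not_square ha hc hab hap hbc.symm hcp hcd hpb.symm hbd hpd had

end Bicluster


/-! ## The search procedure -/

namespace Bicluster

/-- A configuration of the search: the current graph, the number of edits that are still allowed,
the guess (whose ternary digits select the branches), and the current position in the list of all
`6`-tuples of vertices. -/
structure Config (n : ℕ) where
  G : SimpleGraph (Fin n)
  j : ℕ
  r : ℕ
  m : ℕ

/-- The `6`-tuple of vertices with a given position. -/
def tuple {n m : ℕ} (hm : m < n ^ 6) : Fin 6 → Fin n := finFunctionFinEquiv.symm ⟨m, hm⟩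

theorem tuple_apply {n m : ℕ} (hm : m < n ^ 6) (i : Fin 6) :
    (tuple hm i : ℕ) = m / n ^ (i : ℕ) % n := rfl

theorem exists_tuple_eq {n : ℕ} (x : Fin 6 → Fin n) : ∃ (m : ℕ) (hm : m < n ^ 6), tuple hm = x :=
  ⟨finFunctionFinEquiv x, (finFunctionFinEquiv x).2, finFunctionFinEquiv.symm_apply_apply x⟩

/-- The configuration that rejects the current guess. -/
def Config.abort {n : ℕ} (σ : Config n) : Config n := { σ with m := n ^ 6 + 1 }

/-- The configuration after taking a branch. -/
def Config.apply {n : ℕ} (σ : Config n) (x : Fin 6 → Fin n) (b : Branch) : Config n where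
  G := toggleList σ.G (b.edges x)
  j := σ.j - b.pairs.length
  r := σ.r / 3 ^ b.pairs.length
  m := 0

/-- Take the branch that is selected by the guess, if there is one and it is affordable. -/
def Config.branch {n : ℕ} (σ : Config n) (x : Fin 6 → Fin n) : List Branch → Config n
  | [] => σ.abort
  | b :: bs => if σ.r % 3 ^ b.pairs.length = b.code then
      (if b.pairs.length ≤ σ.j then σ.apply x b else σ.abort) else σ.branch x bs

open Classical in
/-- Apply the first rule that matches; if there is none, proceed to the next tuple. -/
noncomputable def Config.next {n : ℕ} (σ : Config n) (x : Fin 6 → Fin n) : List Rule → Config n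
  | [] => { σ with m := σ.m + 1 }
  | ρ :: rs => if ρ.Matches σ.G x then σ.branch x ρ.branches else σ.next x rs

theorem Config.branch_cases {n : ℕ} (σ : Config n) (x : Fin 6 → Fin n) (bs : List Branch) :
    σ.branch x bs = σ.abort ∨
      ∃ b ∈ bs, b.pairs.length ≤ σ.j ∧ σ.branch x bs = σ.apply x b := by
  induction bs with
  | nil => exact Or.inl rfl
  | cons b bs ih =>
    rw [branch]
    split_ifs with h1 h2
    · exact Or.inr ⟨b, List.mem_cons_self, h2, rfl⟩
    · exact Or.inl rfl
    · exact ih.imp_right fun ⟨b', hb', h⟩ => ⟨b', List.mem_cons_of_mem _ hb', h⟩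

/-- The prefix property: an earlier branch reads no more digits than `b` does, and on those digits
it differs from the code of `b`. -/
theorem Config.branch_eq_apply {n : ℕ} {σ : Config n} {x : Fin 6 → Fin n} {b : Branch}
    (hcode : σ.r % 3 ^ b.pairs.length = b.code) (hj : b.pairs.length ≤ σ.j) {bs : List Branch}
    (hb : b ∈ bs) (hbs : bs.Pairwise fun a b =>
      a.pairs.length ≤ b.pairs.length ∧ b.code % 3 ^ a.pairs.length ≠ a.code) :
    σ.branch x bs = σ.apply x b := by
  induction bs with
  | nil => simp at hb
  | cons a bs ih =>
    rw [List.pairwise_cons] at hbs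
    rw [branch]
    rcases List.mem_cons.1 hb with rfl | hb
    · rw [if_pos hcode, if_pos hj]
    · obtain ⟨h1, h2⟩ := hbs.1 b hb
      rw [if_neg, ih hb hbs.2]
      rwa [← hcode, Nat.mod_mod_of_dvd _ (pow_dvd_pow 3 h1)] at h2

theorem Config.next_cases {n : ℕ} (σ : Config n) (x : Fin 6 → Fin n) (rs : List Rule) :
    ((∀ ρ ∈ rs, ¬ ρ.Matches σ.G x) ∧ σ.next x rs = { σ with m := σ.m + 1 }) ∨
      ∃ ρ ∈ rs, ρ.Matches σ.G x ∧ σ.next x rs = σ.branch x ρ.branches := by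
  induction rs with
  | nil => exact Or.inl ⟨by simp, rfl⟩
  | cons ρ rs ih =>
    rw [next]
    split_ifs with h
    · exact Or.inr ⟨ρ, List.mem_cons_self, h, rfl⟩
    · refine ih.imp (fun ⟨h1, h2⟩ => ⟨?_, h2⟩) fun ⟨ρ', hρ', h⟩ =>
        ⟨ρ', List.mem_cons_of_mem _ hρ', h⟩
      exact List.forall_mem_cons.2 ⟨h, h1⟩

/-- The search accepts from a given configuration. -/
inductive Config.Accepts {n : ℕ} : Config n → Prop
  | done {σ : Config n} : σ.m = n ^ 6 → σ.Accepts
  | step {σ : Config n} (hm : σ.m < n ^ 6) : (σ.next (tuple hm) rules).Accepts → σ.Accepts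

theorem Config.accepts_iff {n : ℕ} {σ : Config n} (hm : σ.m < n ^ 6) :
    σ.Accepts ↔ (σ.next (tuple hm) rules).Accepts :=
  ⟨fun h => by
    cases h with
    | done h => omega
    | step _ h => exact h, .step hm⟩

theorem Config.accepts_iff_of_le {n : ℕ} {σ : Config n} (hm : n ^ 6 ≤ σ.m) :
    σ.Accepts ↔ σ.m = n ^ 6 :=
  ⟨fun h => by
    cases h with
    | done h => exact h
    | step h => omega, .done⟩

/-- The position `n ^ 6 + 1` is past the accepting position `n ^ 6`, so the search stops there
without accepting. -/
theorem Config.not_accepts_abort {n : ℕ} (σ : Config n) : ¬ σ.abort.Accepts := by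
  rw [accepts_iff_of_le (Nat.le_succ _)]
  exact Nat.succ_ne_self _

/-- Acceptance means that a full scan found no match, so the final graph is irreducible and hence a
bicluster graph; the edits on the way were paid for from the budget. The hypothesis on earlier
positions holds vacuously after each branch, because the scan restarts at 0. -/
theorem Config.Accepts.biclusterEditing {n : ℕ} {σ : Config n} (h : σ.Accepts)
    (hprev : ∀ m (hm : m < n ^ 6), m < σ.m → ∀ ρ ∈ rules, ¬ ρ.Matches σ.G (tuple hm)) :
    BiclusterEditing σ.G σ.j := by
  induction h with
  | @done σ h =>
    have hirr : Irreducible σ.G := fun ρ hρ x hx => by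
      obtain ⟨m, hm, rfl⟩ := exists_tuple_eq x
      exact hprev m hm (h ▸ hm) ρ hρ hx
    refine biclusterEditing_iff.2 ⟨σ.G, hirr.walkClosed, ?_⟩
    simp [edits]
  | @step σ hm hacc ih =>
    rcases σ.next_cases (tuple hm) rules with ⟨hno, heq⟩ | ⟨ρ, hρ, hmatch, heq⟩
    · rw [heq] at ih
      refine ih fun m' hm' hlt => ?_
      rcases Nat.lt_succ_iff_lt_or_eq.1 hlt with hlt | rfl
      exacts [hprev m' hm' hlt, hno]
    · rcases σ.branch_cases (tuple hm) ρ.branches with h | ⟨b, hb, hj, h⟩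
      · rw [heq, h] at hacc
        exact absurd hacc σ.not_accepts_abort
      · rw [heq, h] at ih
        have := biclusterEditing_of_toggleList _ (ih fun m' _ h => absurd h (Nat.not_lt_zero _))
        simpa [apply, Branch.edges, Nat.sub_add_cancel hj] using this

/-- The guess is assembled from the last choice backwards: by validity some branch approaches an
optimal solution, and its code is placed below the digits of the guess for the remaining budget. -/
theorem exists_accepts {n : ℕ} (j : ℕ) : ∀ (G : SimpleGraph (Fin n)), BiclusterEditing G j →
    ∀ d m, m + d = n ^ 6 → ∃ r < 3 ^ j, (Config.mk G j r m).Accepts := by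
  induction j using Nat.strong_induction_on with
  | _ j ihj =>
    intro G hG d
    induction d with
    | zero => exact fun m hm => ⟨0, by positivity, .done hm⟩
    | succ d ihd =>
      intro m hm
      have hm' : m < n ^ 6 := by omega
      by_cases hex : ∃ ρ ∈ rules, ρ.Matches G (tuple hm')
      · obtain ⟨ρ₀, hρ₀, hmatch₀⟩ := hex
        -- The rule applied does not depend on `r`, so it is known before `r` is chosen.
        obtain ⟨ρ, hρ, hmatch, heq⟩ : ∃ ρ ∈ rules, ρ.Matches G (tuple hm') ∧
            ∀ r, (Config.mk G j r m).next (tuple hm') rules =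
              (Config.mk G j r m).branch (tuple hm') ρ.branches := by
          have key : ∀ rs : List Rule, (∃ ρ ∈ rs, ρ.Matches G (tuple hm')) →
              ∃ ρ ∈ rs, ρ.Matches G (tuple hm') ∧
              ∀ r, (Config.mk G j r m).next (tuple hm') rs =
                (Config.mk G j r m).branch (tuple hm') ρ.branches := by
            intro rs
            induction rs with
            | nil => simp
            | cons ρ rs ih =>
              intro hex
              by_cases h : ρ.Matches G (tuple hm')
              · exact ⟨ρ, List.mem_cons_self, h, fun r => if_pos h⟩
              · obtain ⟨ρ', hρ', h', heq⟩ := ih (by simpa [h] using hex)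
                exact ⟨ρ', List.mem_cons_of_mem _ hρ', h', fun r => (if_neg h).trans (heq r)⟩
          exact key rules ⟨ρ₀, hρ₀, hmatch₀⟩
        obtain ⟨H, hH, hGH⟩ := biclusterEditing_iff.1 hG
        obtain ⟨b, hb, H', ⟨hH', hle⟩, hed, hnd⟩ := rules_valid ρ hρ n G H _ hmatch hH
        have hdist := ncard_edits_toggleList (b.edges (tuple hm')) hed hnd
        rw [Branch.edges, List.length_map, ← Branch.edges] at hdist
        obtain ⟨hpos, hpair⟩ := rules_decodable ρ hρ
        obtain ⟨hlen, hcode⟩ := hpos b hb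
        obtain ⟨r, hr, hacc⟩ := ihj (j - b.pairs.length) (by omega) 
          (toggleList G (b.edges (tuple hm')))
          (biclusterEditing_iff.2 ⟨H', hH', by omega⟩) (n ^ 6) 0 (by omega)
        refine ⟨b.code + 3 ^ b.pairs.length * r, ?_, .step hm' ?_⟩
        · calc b.code + 3 ^ b.pairs.length * r < 3 ^ b.pairs.length * (r + 1) := by
                rw [mul_add, mul_one]; omega
            _ ≤ 3 ^ b.pairs.length * 3 ^ (j - b.pairs.length) := Nat.mul_le_mul_left _ hr
            _ = 3 ^ j := by rw [← pow_add]; congr 1; omega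
        · rw [heq, Config.branch_eq_apply (b := b) _ (by simp only; omega) hb hpair]
          · have : (b.code + 3 ^ b.pairs.length * r) / 3 ^ b.pairs.length = r := by
              rw [Nat.add_mul_div_left _ _ (by positivity), Nat.div_eq_of_lt hcode, zero_add]
            simpa only [Config.apply, this] using hacc
          · simp [Nat.mod_eq_of_lt hcode]
      · obtain ⟨r, hr, hacc⟩ := ihd (m + 1) (by omega)
        refine ⟨r, hr, .step hm' ?_⟩
        rcases (Config.mk G j r m).next_cases (tuple hm') rules with ⟨-, heq⟩ | ⟨ρ, hρ, hmatch, -⟩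
        · rwa [heq]
        · exact absurd ⟨ρ, hρ, hmatch⟩ hex

/-- A guess below `3 ^ k` that makes the search accept exists exactly for the yes-instances. -/
theorem biclusterEditing_iff_exists_accepts {n k : ℕ} {G : SimpleGraph (Fin n)} :
    BiclusterEditing G k ↔ ∃ r < 3 ^ k, (Config.mk G k r 0).Accepts :=
  ⟨fun h => exists_accepts k G h (n ^ 6) 0 (by omega),
    fun ⟨_, _, h⟩ => h.biclusterEditing fun _ _ h => absurd h (Nat.not_lt_zero _)⟩

end Bicluster


/-! ## Running time of random access machine programs -/

namespace RAM

/-- All registers and array entries are at most `V`. -/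
def State.Bounded (s : State) (V : ℕ) : Prop := (∀ x, s.reg x ≤ V) ∧ ∀ a i, s.arr a i ≤ V

theorem State.Bounded.mono {s : State} {V W : ℕ} (h : s.Bounded V) (hVW : V ≤ W) : s.Bounded W :=
  ⟨fun x => (h.1 x).trans hVW, fun a i => (h.2 a i).trans hVW⟩

theorem State.Bounded.setReg {s : State} {V : ℕ} (h : s.Bounded V) (x : ℕ) {v : ℕ} (hv : v ≤ V) :
    (s.setReg x v).Bounded V := by
  refine ⟨fun y => ?_, h.2⟩
  rcases eq_or_ne y x with rfl | hy
  · simpa [State.setReg] using hv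
  · simpa [State.setReg, hy] using h.1 y

theorem State.Bounded.setArr {s : State} {V : ℕ} (h : s.Bounded V) (a i : ℕ) {v : ℕ}
    (hv : v ≤ V) : (s.setArr a i v).Bounded V := by
  refine ⟨h.1, fun b j => ?_⟩
  rcases eq_or_ne b a with rfl | hb
  · rcases eq_or_ne j i with rfl | hj
    · simpa [State.setArr] using hv
    · simpa [State.setArr, hj] using h.2 b j
  · simpa [State.setArr, hb] using h.2 b j

theorem one_le_size {V : ℕ} (hV : 2 ≤ V) : 1 ≤ V.size := Nat.size_pos.2 (by omega)

theorem size_pow_le {V : ℕ} (hV : 2 ≤ V) (c : ℕ) : (V ^ c).size ≤ (c + 1) * V.size := by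
  have h1 := one_le_size hV
  rw [Nat.size_le, add_mul, one_mul, pow_add, mul_comm c, pow_mul]
  calc V ^ c ≤ (2 ^ V.size) ^ c := Nat.pow_le_pow_left V.lt_size_self.le c
    _ < (2 ^ V.size) ^ c * 2 ^ V.size :=
      lt_mul_of_one_lt_right (by positivity) (Nat.one_lt_two_pow (by omega))

theorem size_le_of_le_pow {V v c : ℕ} (hV : 2 ≤ V) (hv : v ≤ V ^ c) :
    v.size ≤ (c + 1) * V.size := (Nat.size_le_size hv).trans (size_pow_le hV c)

/-- The extra factor `V ≥ 2` in the bound pays for the doubling in a sum. -/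
theorem Op.eval_le {o : Op} {V m n a b : ℕ} (hV : 2 ≤ V) (hm : m ≤ V ^ a) (hn : n ≤ V ^ b) :
    o.eval m n ≤ V ^ (a + b + 1) := by
  have ha : 1 ≤ V ^ a := Nat.one_le_pow _ _ (by omega)
  have hb : 1 ≤ V ^ b := Nat.one_le_pow _ _ (by omega)
  have h1 : V ^ a ≤ V ^ (a + b + 1) := Nat.pow_le_pow_right (by omega) (by omega)
  have h2 : 1 ≤ V ^ (a + b + 1) := Nat.one_le_pow _ _ (by omega)
  cases o with
  | add =>
    calc m + n ≤ V ^ (a + b) + V ^ (a + b) := Nat.add_le_add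
          (hm.trans (Nat.pow_le_pow_right (by omega) (by omega)))
          (hn.trans (Nat.pow_le_pow_right (by omega) (by omega)))
      _ ≤ V ^ (a + b + 1) := by rw [pow_succ]; nlinarith [Nat.one_le_pow (a + b) V (by omega)]
  | sub => exact (Nat.sub_le m n).trans (hm.trans h1)
  | mul =>
    calc m * n ≤ V ^ a * V ^ b := Nat.mul_le_mul hm hn
      _ = V ^ (a + b) := (pow_add _ _ _).symm
      _ ≤ V ^ (a + b + 1) := Nat.pow_le_pow_right (by omega) (by omega)
  | div => exact (Nat.div_le_self m n).trans (hm.trans h1)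
  | lt => simp only [Op.eval]; split_ifs <;> omega
  | eq => simp only [Op.eval]; split_ifs <;> omega

theorem Expr.exists_bound (e : Expr) : ∃ c, ∀ (s : State) (V : ℕ), 2 ≤ V → s.Bounded V →
    e.eval s ≤ V ^ c ∧ e.cost s ≤ c * V.size := by
  induction e with
  | const v =>
    refine ⟨v + 2, fun s V hV hs => ?_⟩
    have h1 := one_le_size hV
    have h2 : v ≤ V ^ v := (Nat.lt_pow_self (by omega)).le
    have h3 := size_le_of_le_pow hV h2
    refine ⟨h2.trans (Nat.pow_le_pow_right (by omega) (by omega)), ?_⟩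
    simp only [cost]
    nlinarith
  | reg x =>
    refine ⟨2, fun s V hV hs => ?_⟩
    have h1 := one_le_size hV
    have h3 := Nat.size_le_size (hs.1 x)
    refine ⟨(hs.1 x).trans (Nat.le_self_pow (by omega) V), ?_⟩
    simp only [cost]
    omega
  | get a i ih =>
    obtain ⟨c, hc⟩ := ih
    refine ⟨c + 2, fun s V hV hs => ?_⟩
    have h1 := one_le_size hV
    have h3 := Nat.size_le_size (hs.2 a (i.eval s))
    refine ⟨(hs.2 a _).trans (Nat.le_self_pow (by omega) V), ?_⟩
    have h4 := (hc s V hV hs).2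
    simp only [cost]
    nlinarith
  | op o e₁ e₂ ih₁ ih₂ =>
    obtain ⟨c₁, hc₁⟩ := ih₁
    obtain ⟨c₂, hc₂⟩ := ih₂
    refine ⟨2 * (c₁ + c₂) + 4, fun s V hV hs => ?_⟩
    have h1 := one_le_size hV
    obtain ⟨h2, h3⟩ := hc₁ s V hV hs
    obtain ⟨h4, h5⟩ := hc₂ s V hV hs
    have h6 := Op.eval_le (o := o) hV h2 h4
    have h7 := size_le_of_le_pow hV h6
    refine ⟨h6.trans (Nat.pow_le_pow_right (by omega) (by omega)), ?_⟩
    simp only [cost]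
    nlinarith

/-! ### Programs without loops -/

/-- The program contains no loop. -/
def Program.LoopFree : Program → Prop
  | .skip => True
  | .set _ _ => True
  | .put _ _ _ => True
  | .seq p q => p.LoopFree ∧ q.LoopFree
  | .ite _ p q => p.LoopFree ∧ q.LoopFree
  | .while _ _ => False

/-- The final state of a program without loops. -/
def Program.run : Program → State → State
  | .skip, s => s
  | .set x e, s => s.setReg x (e.eval s)
  | .put a i e, s => s.setArr a (i.eval s) (e.eval s)
  | .seq p q, s => q.run (p.run s)
  | .ite e p q, s => if e.eval s ≠ 0 then p.run s else q.run s
  | .while _ _, s => s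

/-- Values stay polynomial in `V`, so their lengths stay linear in `V.size`. The exponent grows with
the program; inside loops the bound on memory is therefore restored by an invariant. -/
theorem Program.exists_bound {p : Program} (hp : p.LoopFree) :
    ∃ c, ∀ (s : State) (V : ℕ), 2 ≤ V → s.Bounded V →
      (p.run s).Bounded (V ^ c) ∧ ∃ t ≤ c * V.size, Exec p s (p.run s) t := by
  induction p with
  | skip =>
    refine ⟨1, fun s V hV hs => ⟨by simpa [run] using hs, 1, ?_, .skip s⟩⟩
    have h1 := one_le_size hV
    omega
  | set x e =>
    obtain ⟨c, hc⟩ := e.exists_bound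
    refine ⟨c + 1, fun s V hV hs => ⟨?_, _, ?_, .set s x e⟩⟩
    · exact (hs.mono (Nat.le_self_pow (by omega) V)).setReg _
        ((hc s V hV hs).1.trans (Nat.pow_le_pow_right (by omega) (by omega)))
    · have h1 := one_le_size hV
      have h2 := (hc s V hV hs).2
      nlinarith
  | put a i e =>
    obtain ⟨c, hc⟩ := e.exists_bound
    obtain ⟨c', hc'⟩ := i.exists_bound
    refine ⟨c + c' + 1, fun s V hV hs => ⟨?_, _, ?_, .put s a i e⟩⟩
    · exact (hs.mono (Nat.le_self_pow (by omega) V)).setArr _ _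
        ((hc s V hV hs).1.trans (Nat.pow_le_pow_right (by omega) (by omega)))
    · have h1 := one_le_size hV
      have h2 := (hc s V hV hs).2
      have h3 := (hc' s V hV hs).2
      nlinarith
  | seq p q ihp ihq =>
    obtain ⟨c, hc⟩ := ihp hp.1
    obtain ⟨c', hc'⟩ := ihq hp.2
    refine ⟨c + c' * (c + 2), fun s V hV hs => ?_⟩
    obtain ⟨h1, t, ht, hex⟩ := hc s V hV hs
    have hV1 : V ≤ V ^ (c + 1) := Nat.le_self_pow (by omega) V
    -- The exponent `c + 1` instead of `c` keeps the new bound at least 2 even if `c = 0`.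
    obtain ⟨h2, t', ht', hex'⟩ := hc' (p.run s) (V ^ (c + 1)) (hV.trans hV1)
      (h1.mono (Nat.pow_le_pow_right (by omega) (by omega)))
    have hsize := size_pow_le hV (c + 1)
    rw [← pow_mul] at h2
    refine ⟨h2.mono (Nat.pow_le_pow_right (by omega) (by nlinarith)), _, ?_, .seq hex hex'⟩
    calc t + t' ≤ c * V.size + c' * ((c + 1 + 1) * V.size) :=
          Nat.add_le_add ht (ht'.trans (Nat.mul_le_mul_left _ hsize))
      _ = (c + c' * (c + 2)) * V.size := by ring
  | ite e p q ihp ihq =>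
    obtain ⟨c₀, hc₀⟩ := e.exists_bound
    obtain ⟨c, hc⟩ := ihp hp.1
    obtain ⟨c', hc'⟩ := ihq hp.2
    refine ⟨c₀ + c + c' + 1, fun s V hV hs => ?_⟩
    have h0 := (hc₀ s V hV hs).2
    have h1 := one_le_size hV
    rw [run]
    split_ifs with h
    · obtain ⟨h1, t, ht, hex⟩ := hc s V hV hs
      exact ⟨h1.mono (Nat.pow_le_pow_right (by omega) (by omega)), _, by nlinarith,
        .ite_true h hex⟩
    · obtain ⟨h1, t, ht, hex⟩ := hc' s V hV hs
      exact ⟨h1.mono (Nat.pow_le_pow_right (by omega) (by omega)), _, by nlinarith,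
        .ite_false (not_not.1 h) hex⟩
  | _ => exact hp.elim

/-- Started in `s`, the program `p` halts within time `T` in a state that satisfies `Q`. -/
def Runs (p : Program) (s : State) (T : ℕ) (Q : State → Prop) : Prop :=
  ∃ s' t, Exec p s s' t ∧ t ≤ T ∧ Q s'

theorem Runs.mono {p : Program} {s : State} {T T' : ℕ} {Q Q' : State → Prop} (h : Runs p s T Q)
    (hT : T ≤ T') (hQ : ∀ s', Q s' → Q' s') : Runs p s T' Q' :=
  let ⟨s', t, hex, ht, hq⟩ := h
  ⟨s', t, hex, ht.trans hT, hQ s' hq⟩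

theorem Runs.seq {p q : Program} {s : State} {T T' : ℕ} {Q R : State → Prop} (h : Runs p s T Q)
    (h' : ∀ s', Q s' → Runs q s' T' R) : Runs (.seq p q) s (T + T') R :=
  let ⟨s', _, hex, ht, hq⟩ := h
  let ⟨s'', _, hex', ht', hr⟩ := h' s' hq
  ⟨s'', _, .seq hex hex', Nat.add_le_add ht ht', hr⟩

theorem Program.LoopFree.exists_runs {p : Program} (hp : p.LoopFree) :
    ∃ c, ∀ (s : State) (V : ℕ), 2 ≤ V → s.Bounded V → Runs p s (c * V.size) (· = p.run s) :=
  let ⟨c, hc⟩ := Program.exists_bound hp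
  ⟨c, fun s V hV hs => let ⟨_, t, ht, hex⟩ := hc s V hV hs; ⟨_, t, hex, ht, rfl⟩⟩

/-- Running time of a loop with an invariant and a decreasing measure. -/
theorem Runs.while {e : Expr} {p : Program} {I : State → Prop} {μ : State → ℕ} {T T' : ℕ}
    (hbody : ∀ s, I s → e.eval s ≠ 0 → Runs p s T fun s' => I s' ∧ μ s' < μ s)
    (hcost : ∀ s, I s → e.cost s ≤ T') {s : State} (hs : I s) :
    Runs (.while e p) s ((μ s + 1) * (1 + T' + T)) fun s' => I s' ∧ e.eval s' = 0 := by
  induction h : μ s using Nat.strong_induction_on generalizing s with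
  | _ k ih =>
    have hc := hcost s hs
    by_cases he : e.eval s = 0
    · refine ⟨s, _, .while_false he, ?_, hs, he⟩
      calc 1 + e.cost s ≤ 1 * (1 + T' + T) := by omega
        _ ≤ (k + 1) * (1 + T' + T) := Nat.mul_le_mul_right _ (by omega)
    · obtain ⟨s', t, hex, ht, hI, hlt⟩ := hbody s hs he
      obtain ⟨s'', t', hex', ht', hQ⟩ := ih (μ s') (h ▸ hlt) hI rfl
      refine ⟨s'', _, .while_true he hex hex', ?_, hQ⟩
      have : (μ s' + 1) * (1 + T' + T) ≤ k * (1 + T' + T) := Nat.mul_le_mul_right _ (by omega)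
      rw [add_mul k]
      omega

end RAM


/-! ## The program -/

namespace Bicluster

open RAM

/-- The register that holds the `i`-th vertex of the current tuple. -/
def vertex (i : Fin 6) : Expr := .reg (10 + i)

/-- The position of the pair of the `i`-th and the `j`-th vertex in the adjacency matrix. -/
def cell (i j : Fin 6) : Expr := .op .add (.op .mul (vertex i) (.reg 0)) (vertex j)

/-- The truth value of a negation. -/
def notExpr (e : Expr) : Expr := .op .sub (.const 1) e

/-- An expression that is non-zero if the condition holds. -/
def Lit.expr : Lit → Expr
  | .adj i j => .get 1 (cell i j)
  | .nadj i j => notExpr (.get 1 (cell i j))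
  | .ne i j => notExpr (.op .eq (vertex i) (vertex j))
  | .diff i j l => notExpr (.op .eq (.get 1 (cell i l)) (.get 1 (cell j l)))
  | .deg i c => .op .eq (.get 2 (vertex i)) (.const c)

/-- An expression that is non-zero if all conditions hold. -/
def patternExpr : List Lit → Expr
  | [] => .const 1
  | l :: L => .op .mul l.expr (patternExpr L)

/-- Change the adjacency of two vertices of the current tuple. -/
def toggleProg (e : Fin 6 × Fin 6) : Program :=
  .seq (.put 1 (cell e.1 e.2) (.op .mul (notExpr (.get 1 (cell e.1 e.2)))
    (notExpr (.op .eq (vertex e.1) (vertex e.2)))))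
  (.put 1 (cell e.2 e.1) (.get 1 (cell e.1 e.2)))

/-- Change the adjacency of several pairs of vertices of the current tuple. -/
def toggleListProg : List (Fin 6 × Fin 6) → Program
  | [] => .skip
  | e :: L => .seq (toggleProg e) (toggleListProg L)

/-- Reject the current guess. -/
def abortProg : Program := .set 7 (.op .add (.reg 8) (.const 1))

/-- Take a branch. -/
def applyProg (b : Branch) : Program :=
  .seq (toggleListProg b.pairs) <|
  .seq (.set 6 (.op .sub (.reg 6) (.const b.pairs.length))) <|
  .seq (.set 5 (.op .div (.reg 5) (.const (3 ^ b.pairs.length)))) <|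
  .set 7 (.const 0)

/-- Take the branch that is selected by the guess, if there is one and it is affordable. -/
def branchProg : List Branch → Program
  | [] => abortProg
  | b :: bs =>
    .ite (.op .eq (.op .sub (.reg 5) (.op .mul (.op .div (.reg 5) (.const (3 ^ b.pairs.length)))
        (.const (3 ^ b.pairs.length)))) (.const b.code))
      (.ite (.op .lt (.reg 6) (.const b.pairs.length)) abortProg (applyProg b))
      (branchProg bs)

/-- Apply the first rule that matches; if there is none, proceed to the next tuple. -/
def rulesProg : List Rule → Program
  | [] => .set 7 (.op .add (.reg 7) (.const 1))
  | ρ :: rs => .ite (patternExpr ρ.pattern) (branchProg ρ.branches) (rulesProg rs)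

/-- The power of the number of vertices with a given exponent. -/
def powExpr : ℕ → Expr
  | 0 => .const 1
  | i + 1 => .op .mul (powExpr i) (.reg 0)

/-- Compute one vertex of the current tuple. -/
def decodeProg (i : ℕ) : Program :=
  .set (10 + i) (.op .sub (.op .div (.reg 7) (powExpr i))
    (.op .mul (.op .div (.op .div (.reg 7) (powExpr i)) (.reg 0)) (.reg 0)))

/-- One step of the search, after the degrees have been computed. -/
def stepProg : Program :=
  .seq (decodeProg 0) <| .seq (decodeProg 1) <| .seq (decodeProg 2) <| .seq (decodeProg 3) <|
  .seq (decodeProg 4) <| .seq (decodeProg 5) <| rulesProg rules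

/-- There are entries of the matrix left. -/
def cellsLeft : Expr := .op .lt (.reg 9) (.op .mul (.reg 0) (.reg 0))

/-- Add one entry of the matrix to the degree of its row. -/
def degreeStep : Program :=
  .seq (.put 2 (.op .div (.reg 9) (.reg 0)) (.op .add (.get 1 (.reg 9))
    (.op .mul (.get 2 (.op .div (.reg 9) (.reg 0))) (.op .lt (.const 0)
      (.op .sub (.reg 9) (.op .mul (.op .div (.reg 9) (.reg 0)) (.reg 0)))))))
  (.set 9 (.op .add (.reg 9) (.const 1)))

/-- Compute the degrees of all vertices. -/
def degreeProg : Program := .seq (.set 9 (.const 0)) (.while cellsLeft degreeStep)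

/-- Copy one entry of the input matrix. -/
def copyStep : Program :=
  .seq (.put 1 (.reg 9) (.get 0 (.reg 9))) (.set 9 (.op .add (.reg 9) (.const 1)))

/-- Copy the input matrix. -/
def copyProg : Program := .seq (.set 9 (.const 0)) (.while cellsLeft copyStep)

/-- Search until all tuples have been tried or the guess is rejected. -/
def searchProg : Program := .while (.op .lt (.reg 7) (.reg 8)) (.seq degreeProg stepProg)

/-- Start the search with a new guess. -/
def startProg : Program :=
  .seq (.set 5 (.reg 4)) (.seq (.set 6 (.reg 1)) (.set 7 (.const 0)))

/-- Record the result of the search and proceed to the next guess. -/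
def recordProg : Program :=
  .seq (.set 2 (.op .lt (.const 0) (.op .add (.reg 2) (.op .eq (.reg 7) (.reg 8)))))
    (.set 4 (.op .add (.reg 4) (.const 1)))

/-- Try one guess. -/
def guessProg : Program := .seq copyProg (.seq startProg (.seq searchProg recordProg))

/-- Compute the number of guesses and the number of tuples. -/
def initProg : Program :=
  .seq (.set 3 (.const 1)) <|
  .seq (.while (.op .lt (.reg 9) (.reg 1)) (.seq (.set 3 (.op .mul (.const 3) (.reg 3)))
    (.set 9 (.op .add (.reg 9) (.const 1)))))
  (.set 8 (powExpr 6))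

/-- The program for Bicluster Editing. -/
def mainProg : Program :=
  .seq initProg (.seq (.while (.op .lt (.reg 4) (.reg 3)) guessProg) (.set 0 (.reg 2)))

/-! ## The states of the program -/

/-- A bound for all numbers that occur. -/
def valueBound (n k : ℕ) : ℕ := 3 ^ k + (n + 2) ^ 6

theorem two_le_valueBound (n k : ℕ) : 2 ≤ valueBound n k := by
  have h1 : 1 ≤ 3 ^ k := Nat.one_le_pow _ _ (by omega)
  have h2 : 1 ≤ (n + 2) ^ 6 := Nat.one_le_pow _ _ (by omega)
  rw [valueBound]
  omega

/-- From `3 ≤ 4` and `n + 2 < 2 ^ (n + 2)`, both summands are at most `2 ^ (2 * k + 6 * n + 12)`. -/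
theorem size_valueBound_le (n k : ℕ) : (valueBound n k).size ≤ 8 * (n + k + 2) := by
  have h1 : 3 ^ k ≤ 2 ^ (2 * k + 6 * n + 12) :=
    calc 3 ^ k ≤ 4 ^ k := Nat.pow_le_pow_left (by omega) k
      _ = 2 ^ (2 * k) := by rw [pow_mul]; rfl
      _ ≤ 2 ^ (2 * k + 6 * n + 12) := Nat.pow_le_pow_right (by omega) (by omega)
  have h2 : (n + 2) ^ 6 < 2 ^ (2 * k + 6 * n + 12) :=
    calc (n + 2) ^ 6 < (2 ^ (n + 2)) ^ 6 :=
          Nat.pow_lt_pow_left (Nat.lt_two_pow_self) (by omega)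
      _ = 2 ^ (6 * n + 12) := by rw [← pow_mul]; congr 1; ring
      _ ≤ 2 ^ (2 * k + 6 * n + 12) := Nat.pow_le_pow_right (by omega) (by omega)
  have h3 : (valueBound n k).size ≤ 2 * k + 6 * n + 13 := by
    rw [Nat.size_le, valueBound, pow_succ 2 (2 * k + 6 * n + 12)]
    omega
  omega

theorem pow_six_lt_valueBound (n k : ℕ) : n ^ 6 < valueBound n k := by
  have h1 : 1 ≤ 3 ^ k := Nat.one_le_pow _ _ (by omega)
  have h2 : n ^ 6 ≤ (n + 2) ^ 6 := Nat.pow_le_pow_left (by omega) 6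
  rw [valueBound]
  omega

theorem mul_self_le_pow_six (n : ℕ) : n * n ≤ n ^ 6 := by
  rcases Nat.eq_zero_or_pos n with rfl | hn
  · simp
  · rw [← sq]
    exact Nat.pow_le_pow_right hn (by omega)

open Classical in
/-- An entry of the adjacency matrix. -/
noncomputable def adjBit {n : ℕ} (G : SimpleGraph (Fin n)) (i j : Fin n) : ℕ :=
  if G.Adj i j then 1 else 0

theorem adjBit_of_adj {n : ℕ} {G : SimpleGraph (Fin n)} {i j : Fin n} (h : G.Adj i j) :
    adjBit G i j = 1 := if_pos h

theorem adjBit_of_not_adj {n : ℕ} {G : SimpleGraph (Fin n)} {i j : Fin n} (h : ¬ G.Adj i j) :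
    adjBit G i j = 0 := if_neg h

theorem adjBit_le_one {n : ℕ} (G : SimpleGraph (Fin n)) (i j : Fin n) : adjBit G i j ≤ 1 := by
  rw [adjBit]
  split_ifs <;> omega

theorem adjBit_ne_zero {n : ℕ} {G : SimpleGraph (Fin n)} {i j : Fin n} :
    adjBit G i j ≠ 0 ↔ G.Adj i j := by
  simp [adjBit]

theorem cell_inj {n : ℕ} {i j i' j' : Fin n} :
    (i * n + j : ℕ) = i' * n + j' ↔ i = i' ∧ j = j' := by
  constructor
  · intro h
    have key : ∀ a b : Fin n, (a * n + b : ℕ) / n = a := fun a b => by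
      rw [mul_comm, Nat.mul_add_div (by have := b.2; omega), Nat.div_eq_of_lt b.2, add_zero]
    have h1 : i = i' := Fin.ext (by rw [← key i j, h, key])
    subst h1
    exact ⟨rfl, Fin.ext (by omega)⟩
  · rintro ⟨rfl, rfl⟩
    rfl

/-! ### What the memory represents -/

/-- The array `a` holds the adjacency matrix of `G`. -/
def HoldsGraph {n : ℕ} (s : State) (a : ℕ) (G : SimpleGraph (Fin n)) : Prop :=
  ∀ i j : Fin n, s.arr a (i * n + j) = adjBit G i j

/-- The input and the numbers computed from it are in place. -/
structure Base {n : ℕ} (G₀ : SimpleGraph (Fin n)) (k : ℕ) (s : State) : Prop where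
  n_eq : s.reg 0 = n
  k_eq : s.reg 1 = k
  guesses_eq : s.reg 3 = 3 ^ k
  tuples_eq : s.reg 8 = n ^ 6
  graph : HoldsGraph s 0 G₀
  bounded : s.Bounded (valueBound n k)

/-- The input, the numbers computed from it, the current guess and the result are unchanged. -/
def Keeps (s s' : State) : Prop :=
  (∀ x, x < 5 ∨ x = 8 → s'.reg x = s.reg x) ∧ s'.arr 0 = s.arr 0

theorem Keeps.refl (s : State) : Keeps s s := ⟨fun _ _ => rfl, rfl⟩

theorem Keeps.trans {s s' s'' : State} (h : Keeps s s') (h' : Keeps s' s'') : Keeps s s'' :=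
  ⟨fun x hx => (h'.1 x hx).trans (h.1 x hx), h'.2.trans h.2⟩

theorem Keeps.setReg {s s' : State} (h : Keeps s s') {x : ℕ} (hx : 5 ≤ x ∧ x ≠ 8) (v : ℕ) :
    Keeps s (s'.setReg x v) :=
  h.trans ⟨fun y hy => by
    have : y ≠ x := by omega
    simp [State.setReg, this], rfl⟩

theorem Keeps.setArr {s s' : State} (h : Keeps s s') {a : ℕ} (ha : 1 ≤ a) (i v : ℕ) :
    Keeps s (s'.setArr a i v) :=
  h.trans ⟨fun _ _ => rfl, by
    have : 0 ≠ a := by omega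
    simp [State.setArr, this]⟩

theorem Base.of_keeps {n k : ℕ} {G₀ : SimpleGraph (Fin n)} {s s' : State} (h : Base G₀ k s)
    (hk : Keeps s s') (hb : s'.Bounded (valueBound n k)) : Base G₀ k s' where
  n_eq := (hk.1 0 (by omega)).trans h.n_eq
  k_eq := (hk.1 1 (by omega)).trans h.k_eq
  guesses_eq := (hk.1 3 (by omega)).trans h.guesses_eq
  tuples_eq := (hk.1 8 (by omega)).trans h.tuples_eq
  graph := fun i j => by rw [hk.2]; exact h.graph i j
  bounded := hb

/-- The state stores a configuration of the search. -/
structure Stores {n : ℕ} (G₀ : SimpleGraph (Fin n)) (k : ℕ) (s : State) (σ : Config n) :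
    Prop where
  base : Base G₀ k s
  graph : HoldsGraph s 1 σ.G
  r_eq : s.reg 5 = σ.r
  j_eq : s.reg 6 = σ.j
  m_eq : s.reg 7 = σ.m

/-- The array `2` holds the degrees of the vertices. -/
def HoldsDegrees {n : ℕ} (s : State) (G : SimpleGraph (Fin n)) : Prop :=
  ∀ v : Fin n, s.arr 2 v = (nbr G v).card

/-- The registers hold the vertices of a tuple. -/
def HoldsTuple {n : ℕ} (s : State) (x : Fin 6 → Fin n) : Prop :=
  ∀ i : Fin 6, s.reg (10 + i) = x i

/-! ## Correctness of the parts without loops -/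

section

variable {n k : ℕ} {G₀ G : SimpleGraph (Fin n)} {s : State} {σ : Config n} {x : Fin 6 → Fin n}

theorem eval_cell (hn : s.reg 0 = n) (hx : HoldsTuple s x) (i j : Fin 6) :
    (cell i j).eval s = x i * n + x j := by
  have h1 := hx i
  have h2 := hx j
  simp only [cell, vertex, Expr.eval, Op.eval, hn, h1, h2]

theorem eval_notExpr {e : Expr} : (notExpr e).eval s = 1 - e.eval s := rfl

theorem eval_lit_ne_zero (hn : s.reg 0 = n) (hx : HoldsTuple s x) (hG : HoldsGraph s 1 G)
    (hd : HoldsDegrees s G) (l : Lit) : l.expr.eval s ≠ 0 ↔ l.Holds G x := by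
  cases l with
  | adj i j =>
    rw [Lit.expr, Expr.eval, eval_cell hn hx, hG, adjBit_ne_zero, Lit.Holds]
  | nadj i j =>
    rw [Lit.expr, eval_notExpr, Expr.eval, eval_cell hn hx, hG, Lit.Holds, adjBit]
    split_ifs with h <;> simp [h]
  | ne i j =>
    have h1 := hx i
    have h2 := hx j
    simp only [Lit.expr, eval_notExpr, Expr.eval, vertex, Op.eval, h1, h2, Lit.Holds, Fin.val_inj]
    split_ifs with h <;> simp [h]
  | diff i j l =>
    rw [Lit.expr, eval_notExpr, Expr.eval, Expr.eval, Expr.eval, eval_cell hn hx, eval_cell hn hx,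
      hG, hG, Lit.Holds, adjBit, adjBit, Op.eval]
    split_ifs <;> simp_all
  | deg i c =>
    have h1 := hx i
    simp only [Lit.expr, Expr.eval, vertex, Op.eval, h1, Lit.Holds, hd (x i)]
    split_ifs with h <;> simp [h]

theorem eval_patternExpr_ne_zero (hn : s.reg 0 = n) (hx : HoldsTuple s x) (hG : HoldsGraph s 1 G)
    (hd : HoldsDegrees s G) (L : List Lit) :
    (patternExpr L).eval s ≠ 0 ↔ ∀ l ∈ L, l.Holds G x := by
  induction L with
  | nil => simp [patternExpr, Expr.eval]
  | cons l L ih =>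
    rw [patternExpr, Expr.eval, Op.eval, Nat.mul_ne_zero_iff, eval_lit_ne_zero hn hx hG hd, ih,
      List.forall_mem_cons]

theorem run_toggleProg (hn : s.reg 0 = n) (hx : HoldsTuple s x) (hG : HoldsGraph s 1 G)
    {V : ℕ} (hV : 2 ≤ V) (hb : s.Bounded V) (e : Fin 6 × Fin 6) :
    ((toggleProg e).run s).reg = s.reg ∧ (∀ a, a ≠ 1 → ((toggleProg e).run s).arr a = s.arr a) ∧
      ((toggleProg e).run s).Bounded V ∧
      HoldsGraph ((toggleProg e).run s) 1 (toggle G (x e.1) (x e.2)) := by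
  set p : ℕ := x e.1 * n + x e.2 with hp
  set q : ℕ := x e.2 * n + x e.1 with hq
  -- The second factor writes 0 on the diagonal, in agreement with `toggle`, which ignores a pair of
  -- equal vertices.
  set v : ℕ := (1 - s.arr 1 p) * (1 - if (x e.1 : ℕ) = x e.2 then 1 else 0) with hv
  have hrun : (toggleProg e).run s = (s.setArr 1 p v).setArr 1 q v := by
    have hn' : (s.setArr 1 p v).reg 0 = n := hn
    have hx' : HoldsTuple (s.setArr 1 p v) x := hx
    have h1 : (Expr.op .mul (notExpr (.get 1 (cell e.1 e.2)))
        (notExpr (.op .eq (vertex e.1) (vertex e.2)))).eval s = v := by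
      have h1 := hx e.1
      have h2 := hx e.2
      simp only [notExpr, Expr.eval, Op.eval, eval_cell hn hx, vertex, h1, h2, hv, hp]
    have h2 : (Program.put 1 (cell e.1 e.2) (.op .mul (notExpr (.get 1 (cell e.1 e.2)))
        (notExpr (.op .eq (vertex e.1) (vertex e.2))))).run s = s.setArr 1 p v := by
      rw [Program.run, h1, eval_cell hn hx]
    rw [toggleProg, Program.run, h2, Program.run, Expr.eval, eval_cell hn' hx',
      eval_cell hn' hx', ← hp, ← hq]
    simp [State.setArr]
  have hv1 : v ≤ 1 := by
    have h1 : 1 - s.arr 1 p ≤ 1 := Nat.sub_le _ _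
    have h2 : (1 - if (x e.1 : ℕ) = x e.2 then 1 else 0) ≤ 1 := Nat.sub_le _ _
    exact Nat.mul_le_mul h1 h2
  rw [hrun]
  refine ⟨rfl, fun a ha => by simp [State.setArr, ha],
    (hb.setArr _ _ (by omega)).setArr _ _ (by omega), fun a b => ?_⟩
  have hab := hG a b
  have hpp := hG (x e.1) (x e.2)
  simp only [State.setArr, Function.update_self, Function.update_apply, hp, hq, cell_inj]
  simp only [hv, hp, hpp, Fin.val_inj]
  have hcase : s(a, b) = s(x e.1, x e.2) ↔ (a = x e.1 ∧ b = x e.2) ∨ (a = x e.2 ∧ b = x e.1) :=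
    Sym2.eq_iff
  by_cases h : s(a, b) = s(x e.1, x e.2)
  · have hadj : (toggle G (x e.1) (x e.2)).Adj a b ↔ x e.1 ≠ x e.2 ∧ ¬ G.Adj (x e.1) (x e.2) := by
      rw [toggle_adj, ← SimpleGraph.mem_edgeSet, h, SimpleGraph.mem_edgeSet]
      have : a = b ↔ x e.1 = x e.2 := by
        rcases hcase.1 h with ⟨rfl, rfl⟩ | ⟨rfl, rfl⟩
        exacts [Iff.rfl, eq_comm]
      rw [Ne, this]
      simp
    have hl : ∀ {α : Type} (P Q : Prop) [Decidable P] [Decidable Q] (y z : α), P ∨ Q →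
        (if P then y else if Q then y else z) = y := by
      intro α P Q _ _ y z hPQ
      split_ifs <;> tauto
    rw [hl _ _ _ _ (hcase.1 h).symm]
    by_cases h1 : x e.1 = x e.2
    · rw [if_pos h1, adjBit_of_not_adj fun h' => (hadj.1 h').1 h1, Nat.sub_self, mul_zero]
    · rw [if_neg h1, Nat.sub_zero, mul_one]
      by_cases h2 : G.Adj (x e.1) (x e.2)
      · rw [adjBit_of_adj h2, adjBit_of_not_adj fun h' => (hadj.1 h').2 h2]
      · rw [adjBit_of_not_adj h2, adjBit_of_adj (hadj.2 ⟨h1, h2⟩)]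
  · have hadj : (toggle G (x e.1) (x e.2)).Adj a b ↔ G.Adj a b := by
      rw [toggle_adj]
      have := fun h : G.Adj a b => h.ne
      tauto
    rw [hcase] at h
    rw [if_neg (fun h' => h (Or.inr h')), if_neg (fun h' => h (Or.inl h')), hab]
    by_cases h1 : G.Adj a b
    · rw [adjBit_of_adj h1, adjBit_of_adj (hadj.2 h1)]
    · rw [adjBit_of_not_adj h1, adjBit_of_not_adj (mt hadj.1 h1)]

theorem run_toggleListProg (hn : s.reg 0 = n) (hx : HoldsTuple s x)
    {V : ℕ} (hV : 2 ≤ V) (L : List (Fin 6 × Fin 6)) : ∀ {s' : State} {G : SimpleGraph (Fin n)},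
    s'.reg = s.reg → s'.Bounded V → HoldsGraph s' 1 G →
    ((toggleListProg L).run s').reg = s.reg ∧
      (∀ a, a ≠ 1 → ((toggleListProg L).run s').arr a = s'.arr a) ∧
      ((toggleListProg L).run s').Bounded V ∧
      HoldsGraph ((toggleListProg L).run s') 1 (toggleList G (L.map fun e => (x e.1, x e.2))) := by
  induction L with
  | nil => exact fun h hb hG => ⟨h, fun _ _ => rfl, hb, hG⟩
  | cons e L ih =>
    intro s' G h hb hG
    obtain ⟨h1, h2, h3, h4⟩ := run_toggleProg (h ▸ hn) (fun i => h ▸ hx i) hG hV hb e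
    obtain ⟨h5, h6, h7, h8⟩ := ih (h1.trans h) h3 h4
    exact ⟨h5, fun a ha => (h6 a ha).trans (h2 a ha), h7, h8⟩

theorem run_abortProg (h : Stores G₀ k s σ) :
    Stores G₀ k (abortProg.run s) σ.abort ∧ Keeps s (abortProg.run s) := by
  have hk : Keeps s (abortProg.run s) := (Keeps.refl s).setReg (by omega) _
  refine ⟨⟨h.base.of_keeps hk (h.base.bounded.setReg _ ?_), h.graph, h.r_eq, h.j_eq, ?_⟩, hk⟩
  · simpa [Expr.eval, Op.eval, h.base.tuples_eq] using pow_six_lt_valueBound n k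
  · simp [abortProg, Program.run, State.setReg, Expr.eval, Op.eval, h.base.tuples_eq, Config.abort]

theorem run_applyProg (h : Stores G₀ k s σ) (hx : HoldsTuple s x) (b : Branch) :
    Stores G₀ k ((applyProg b).run s) (σ.apply x b) ∧ Keeps s ((applyProg b).run s) := by
  obtain ⟨h1, h2, h3, h4⟩ := run_toggleListProg h.base.n_eq hx (two_le_valueBound n k) b.pairs rfl
    h.base.bounded h.graph
  have hk : Keeps s ((applyProg b).run s) :=
    Keeps.setReg (Keeps.setReg (Keeps.setReg ⟨fun y _ => congrFun h1 y, h2 0 (by omega)⟩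
      (by omega) _) (by omega) _) (by omega) _
  refine ⟨⟨h.base.of_keeps hk ?_, h4, ?_, ?_, ?_⟩, hk⟩
  · refine ((h3.setReg _ ?_).setReg _ ?_).setReg _ ?_
    · simpa [Expr.eval, Op.eval, h1] using (Nat.sub_le _ _).trans (h.base.bounded.1 6)
    · simpa [Expr.eval, Op.eval, h1, State.setReg, Program.run] using
        (Nat.div_le_self _ _).trans (h.base.bounded.1 5)
    · simp [Expr.eval]
  · simp [applyProg, Program.run, State.setReg, Expr.eval, Op.eval, h1, h.r_eq, Config.apply]
  · simp [applyProg, Program.run, State.setReg, Expr.eval, Op.eval, h1, h.j_eq, Config.apply]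
  · simp [applyProg, Program.run, State.setReg, Expr.eval, Config.apply]

theorem run_branchProg (h : Stores G₀ k s σ) (hx : HoldsTuple s x) (bs : List Branch) :
    Stores G₀ k ((branchProg bs).run s) (σ.branch x bs) ∧ Keeps s ((branchProg bs).run s) := by
  induction bs with
  | nil => exact run_abortProg h
  | cons b bs ih =>
    -- The machine has no remainder operation.
    have hmod : σ.r - σ.r / 3 ^ b.pairs.length * 3 ^ b.pairs.length = σ.r % 3 ^ b.pairs.length := by
      have := Nat.div_add_mod' σ.r (3 ^ b.pairs.length)
      omega
    simp only [branchProg, Program.run, Config.branch, Expr.eval, Op.eval, h.r_eq, h.j_eq, hmod]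
    by_cases h1 : σ.r % 3 ^ b.pairs.length = b.code
    · by_cases h2 : b.pairs.length ≤ σ.j
      · simpa [h1, h2, Nat.not_lt.2 h2] using run_applyProg h hx b
      · simpa [h1, h2, Nat.not_le.1 h2] using run_abortProg h
    · simpa [h1] using ih

/-- At most one branch is taken per step, and all tests precede its edits, so the degrees computed
beforehand are still those of `σ.G` whenever a pattern is tested. -/
theorem run_rulesProg (h : Stores G₀ k s σ) (hx : HoldsTuple s x) (hd : HoldsDegrees s σ.G)
    (hm : σ.m < n ^ 6) (rs : List Rule) :
    Stores G₀ k ((rulesProg rs).run s) (σ.next x rs) ∧ Keeps s ((rulesProg rs).run s) := by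
  induction rs with
  | nil =>
    have hk : Keeps s ((rulesProg []).run s) := (Keeps.refl s).setReg (by omega) _
    refine ⟨⟨h.base.of_keeps hk (h.base.bounded.setReg _ ?_), h.graph, h.r_eq, h.j_eq, ?_⟩, hk⟩
    · have := pow_six_lt_valueBound n k
      simp only [Expr.eval, Op.eval, h.m_eq]
      omega
    · simp [rulesProg, Program.run, State.setReg, Expr.eval, Op.eval, h.m_eq, Config.next]
  | cons ρ rs ih =>
    have hpat := eval_patternExpr_ne_zero h.base.n_eq hx h.graph hd ρ.pattern
    rw [rulesProg, Program.run, Config.next]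
    by_cases hρ : ρ.Matches σ.G x
    · rw [if_pos (hpat.2 hρ), if_pos hρ]
      exact run_branchProg h hx ρ.branches
    · rw [if_neg (mt hpat.1 hρ), if_neg hρ]
      exact ih

theorem eval_powExpr (hn : s.reg 0 = n) (i : ℕ) : (powExpr i).eval s = n ^ i := by
  induction i with
  | zero => rfl
  | succ i ih => rw [powExpr, Expr.eval, Op.eval, ih, Expr.eval, hn, pow_succ]

theorem run_decodeProg (hn : s.reg 0 = n) (i : ℕ) :
    (decodeProg i).run s = s.setReg (10 + i) (s.reg 7 / n ^ i % n) := by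
  rw [decodeProg, Program.run]
  congr 1
  simp only [Expr.eval, Op.eval, eval_powExpr hn, hn]
  have := Nat.div_add_mod' (s.reg 7 / n ^ i) n
  omega

/-- The effect of computing one vertex of the current tuple. -/
theorem run_decodeProg_spec (h : Stores G₀ k s σ) (hm : σ.m < n ^ 6) (i : Fin 6) :
    Stores G₀ k ((decodeProg i).run s) σ ∧ Keeps s ((decodeProg i).run s) ∧
      ((decodeProg i).run s).arr = s.arr ∧ ((decodeProg i).run s).reg (10 + i) = tuple hm i ∧
      ∀ j : Fin 6, j ≠ i → ((decodeProg i).run s).reg (10 + j) = s.reg (10 + j) := by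
  rw [run_decodeProg h.base.n_eq, h.m_eq, ← tuple_apply hm]
  have hk : Keeps s (s.setReg (10 + i) (tuple hm i)) := (Keeps.refl s).setReg (by omega) _
  refine ⟨⟨h.base.of_keeps hk (h.base.bounded.setReg _ ?_), h.graph, ?_, ?_, ?_⟩, hk, rfl, ?_, ?_⟩
  · have h1 := h.base.bounded.1 0
    rw [h.base.n_eq] at h1
    exact (tuple hm i).2.le.trans h1
  · rw [← h.r_eq]
    exact Function.update_of_ne (by omega) _ _
  · rw [← h.j_eq]
    exact Function.update_of_ne (by omega) _ _
  · exact (Function.update_of_ne (by omega) _ _).trans h.m_eq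
  · exact Function.update_self _ _ _
  · intro j hj
    exact Function.update_of_ne (by simpa [Fin.val_inj] using hj) _ _

theorem run_stepProg (h : Stores G₀ k s σ) (hd : HoldsDegrees s σ.G) (hm : σ.m < n ^ 6) :
    Stores G₀ k (stepProg.run s) (σ.next (tuple hm) rules) ∧ Keeps s (stepProg.run s) := by
  obtain ⟨h0, k0, a0, x0, -⟩ := run_decodeProg_spec h hm 0
  obtain ⟨h1, k1, a1, x1, y1⟩ := run_decodeProg_spec h0 hm 1
  obtain ⟨h2, k2, a2, x2, y2⟩ := run_decodeProg_spec h1 hm 2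
  obtain ⟨h3, k3, a3, x3, y3⟩ := run_decodeProg_spec h2 hm 3
  obtain ⟨h4, k4, a4, x4, y4⟩ := run_decodeProg_spec h3 hm 4
  obtain ⟨h5, k5, a5, x5, y5⟩ := run_decodeProg_spec h4 hm 5
  have hx : HoldsTuple ((decodeProg 5).run ((decodeProg 4).run ((decodeProg 3).run
      ((decodeProg 2).run ((decodeProg 1).run ((decodeProg 0).run s)))))) (tuple hm) := by
    intro i
    fin_cases i
    · exact (y5 0 (by decide)).trans ((y4 0 (by decide)).trans ((y3 0 (by decide)).trans
        ((y2 0 (by decide)).trans ((y1 0 (by decide)).trans x0))))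
    · exact (y5 1 (by decide)).trans ((y4 1 (by decide)).trans ((y3 1 (by decide)).trans
        ((y2 1 (by decide)).trans x1)))
    · exact (y5 2 (by decide)).trans ((y4 2 (by decide)).trans ((y3 2 (by decide)).trans x2))
    · exact (y5 3 (by decide)).trans ((y4 3 (by decide)).trans x3)
    · exact (y5 4 (by decide)).trans x4
    · exact x5
  obtain ⟨h6, k6⟩ := run_rulesProg h5 hx
    (fun v => (congrFun (congrFun (a5.trans (a4.trans (a3.trans (a2.trans (a1.trans a0))))) 2)
      v).trans (hd v)) hm rules
  exact ⟨h6, k0.trans (k1.trans (k2.trans (k3.trans (k4.trans (k5.trans k6)))))⟩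

end

end Bicluster


/-! ## Correctness and running time of the loops -/

namespace Bicluster

open RAM

/-- The constant depends on the program alone, so any state within `valueBound` can be the start of
a loop body at the same cost. -/
theorem exists_runs_linear {p : Program} (hp : p.LoopFree) :
    ∃ c, ∀ (n k : ℕ) (s : State), s.Bounded (valueBound n k) →
      Runs p s (c * (n + k + 2)) (· = p.run s) := by
  obtain ⟨c, hc⟩ := hp.exists_runs
  refine ⟨c * 8, fun n k s hs => (hc s _ (two_le_valueBound n k) hs).mono ?_ fun _ h => h⟩
  rw [mul_assoc]
  exact Nat.mul_le_mul_left _ (size_valueBound_le n k)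

theorem exists_cost_le_linear (e : Expr) :
    ∃ c, ∀ (n k : ℕ) (s : State), s.Bounded (valueBound n k) → e.cost s ≤ c * (n + k + 2) := by
  obtain ⟨c, hc⟩ := e.exists_bound
  refine ⟨c * 8, fun n k s hs => (hc s _ (two_le_valueBound n k) hs).2.trans ?_⟩
  rw [mul_assoc]
  exact Nat.mul_le_mul_left _ (size_valueBound_le n k)

theorem loop_cost_le {a X c c' i j : ℕ} (ha : a ≤ X ^ i) (hX : 1 ≤ X) (hj : 1 ≤ j) :
    a * (1 + c' * X + c * X ^ j) ≤ (1 + c' + c) * X ^ (i + j) := by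
  have h1 : 1 ≤ X ^ j := Nat.one_le_pow _ _ hX
  have h2 : X ≤ X ^ j := Nat.le_self_pow (by omega) X
  calc a * (1 + c' * X + c * X ^ j) ≤ X ^ i * (1 * X ^ j + c' * X ^ j + c * X ^ j) :=
        Nat.mul_le_mul ha (by rw [one_mul]; gcongr)
    _ = (1 + c' + c) * X ^ (i + j) := by rw [pow_add]; ring

section

variable {n k : ℕ} {G₀ G : SimpleGraph (Fin n)} {s s' : State} {σ : Config n}

theorem eval_cellsLeft_ne_zero (hn : s.reg 0 = n) : cellsLeft.eval s ≠ 0 ↔ s.reg 9 < n * n := by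
  simp only [cellsLeft, Expr.eval, Op.eval, hn]
  split_ifs with h <;> simp [h]

theorem mul_self_lt_valueBound (n k : ℕ) : n * n < valueBound n k :=
  (mul_self_le_pow_six n).trans_lt (pow_six_lt_valueBound n k)

theorem le_valueBound (n k : ℕ) : n ≤ valueBound n k :=
  (Nat.le_mul_self n).trans (mul_self_lt_valueBound n k).le

theorem Base.setCounter (h : Base G₀ k s) {v : ℕ} (hv : v ≤ n * n) :
    Base G₀ k (s.setReg 9 v) :=
  h.of_keeps ((Keeps.refl s).setReg (by omega) v)
    (h.bounded.setReg _ (hv.trans (mul_self_lt_valueBound n k).le))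

theorem Stores.setCounter (h : Stores G₀ k s σ) {v : ℕ} (hv : v ≤ n * n) :
    Stores G₀ k (s.setReg 9 v) σ :=
  ⟨h.base.setCounter hv, h.graph, h.r_eq, h.j_eq, h.m_eq⟩

theorem sum_adjBit (G : SimpleGraph (Fin n)) (v : Fin n) :
    ∑ w, adjBit G v w = (nbr G v).card := by
  classical
  rw [nbr, Finset.card_filter]
  refine Finset.sum_congr rfl fun w _ => ?_
  by_cases h : G.Adj v w
  · rw [adjBit_of_adj h, if_pos h]
  · rw [adjBit_of_not_adj h, if_neg h]

/-- The part of the degree of `v` that is due to the matrix entries before position `i`. -/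
def rowSum (n : ℕ) (s : State) (v i : ℕ) : ℕ :=
  ∑ q ∈ Finset.range (min n (i - v * n)), s.arr 1 (v * n + q)

theorem rowSum_le (hG : HoldsGraph s 1 G) (v : Fin n) (i : ℕ) : rowSum n s v i ≤ n := by
  calc rowSum n s v i ≤ ∑ _q ∈ Finset.range (min n (i - v * n)), 1 :=
        Finset.sum_le_sum fun q hq => by
          have hq' : q < n := by rw [Finset.mem_range] at hq; omega
          exact (hG v ⟨q, hq'⟩).trans_le (adjBit_le_one _ _ _)
    _ ≤ n := by simp

theorem rowSum_eq_card (hG : HoldsGraph s 1 G) (v : Fin n) :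
    rowSum n s v (n * n) = (nbr G v).card := by
  have h : min n (n * n - v * n) = n := by
    have h1 : (v + 1) * n ≤ n * n := Nat.mul_le_mul_right _ v.2
    rw [add_mul] at h1
    omega
  rw [rowSum, h, Finset.sum_range, ← sum_adjBit]
  exact Finset.sum_congr rfl fun w _ => hG v w

/-- The invariant of the loop that computes the degrees. -/
structure DegreeInv (G₀ : SimpleGraph (Fin n)) (k : ℕ) (σ : Config n) (s s' : State) : Prop where
  stores : Stores G₀ k s' σ
  keeps : Keeps s s'
  counter : s'.reg 9 ≤ n * n
  sums : ∀ v : Fin n, v * n < s'.reg 9 → s'.arr 2 v = rowSum n s' v (s'.reg 9)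

theorem run_degreeStep (h : DegreeInv G₀ k σ s s') (hlt : s'.reg 9 < n * n) :
    DegreeInv G₀ k σ s (degreeStep.run s') ∧ (degreeStep.run s').reg 9 = s'.reg 9 + 1 := by
  set i := s'.reg 9 with hi
  have hn : 0 < n := by
    rcases Nat.eq_zero_or_pos n with rfl | hn
    · simp at hlt
    · exact hn
  obtain ⟨v, hv⟩ : ∃ v : Fin n, (v : ℕ) = i / n := ⟨⟨i / n, Nat.div_lt_of_lt_mul hlt⟩, rfl⟩
  obtain ⟨q, hq⟩ : ∃ q : Fin n, (q : ℕ) = i % n := ⟨⟨i % n, Nat.mod_lt _ hn⟩, rfl⟩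
  have hiq : i = v * n + q := by rw [hv, hq]; exact (Nat.div_add_mod' i n).symm
  -- In the first column of a row the factor is 0 and discards the old content of array 2, so that
  -- array never has to be cleared.
  have hnew : s'.arr 1 i + s'.arr 2 v * (if 0 < i - v * n then 1 else 0) =
      rowSum n s' v (i + 1) := by
    have h1 : min n (i + 1 - v * n) = q + 1 := by have := q.2; omega
    rw [rowSum, h1, Finset.sum_range_succ, ← hiq, add_comm]
    congr 1
    split_ifs with h0
    · have h2 : min n (i - v * n) = q := by have := q.2; omega
      rw [mul_one, h.sums v (by omega), rowSum, ← hi, h2]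
    · have : (q : ℕ) = 0 := by omega
      simp [this]
  have hrun : degreeStep.run s' = (s'.setArr 2 v (rowSum n s' v (i + 1))).setReg 9 (i + 1) := by
    rw [← hnew, hv]
    simp only [degreeStep, Program.run, Expr.eval, Op.eval, h.stores.base.n_eq, ← hi,
      State.setArr]
  rw [hrun]
  have hle := rowSum_le h.stores.graph v (i + 1)
  have hst : Stores G₀ k (s'.setArr 2 v (rowSum n s' v (i + 1))) σ :=
    ⟨h.stores.base.of_keeps ((Keeps.refl s').setArr (by omega) _ _)
      (h.stores.base.bounded.setArr _ _ (hle.trans (le_valueBound n k))),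
      fun a b => by simpa [State.setArr] using h.stores.graph a b, h.stores.r_eq, h.stores.j_eq,
      h.stores.m_eq⟩
  have hreg : ((s'.setArr 2 v (rowSum n s' v (i + 1))).setReg 9 (i + 1)).reg 9 = i + 1 := by
    simp [State.setReg]
  refine ⟨⟨hst.setCounter hlt, (h.keeps.setArr (by omega) _ _).setReg (by omega) _,
    hreg.trans_le hlt, fun w hw => ?_⟩, hreg⟩
  rw [hreg] at hw ⊢
  have hrow : ∀ w : ℕ, rowSum n ((s'.setArr 2 v (rowSum n s' v (i + 1))).setReg 9 (i + 1)) w (i + 1)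
      = rowSum n s' w (i + 1) := fun w => by simp [rowSum, State.setArr, State.setReg]
  rw [hrow]
  by_cases hwv : w = v
  · subst hwv
    simp [State.setArr, State.setReg]
  · have hwv' : (w : ℕ) ≠ v := fun h => hwv (Fin.ext h)
    have hlt' : (w : ℕ) < v := by
      by_contra hge
      have : (v + 1) * n ≤ w * n := Nat.mul_le_mul_right _ (by omega)
      rw [add_mul] at this
      have := q.2
      omega
    have h3 : (w + 1) * n ≤ v * n := Nat.mul_le_mul_right _ hlt'
    rw [add_mul] at h3
    -- Row `w` precedes row `v`, hence it is complete and its sum no longer changes.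
    have h4 : min n (i - w * n) = n := by omega
    have h5 : min n (i + 1 - w * n) = n := by omega
    have h6 := h.sums w (by omega)
    rw [rowSum, ← hi, h4] at h6
    have h7 : rowSum n s' w (i + 1) = s'.arr 2 w := by rw [rowSum, h5, h6]
    rw [h7]
    simp [State.setArr, State.setReg, hwv']

end

theorem mul_self_add_one_le (n k : ℕ) : n * n + 1 ≤ (n + k + 2) ^ 2 := by
  nlinarith [Nat.zero_le (k * n), Nat.zero_le (k * k)]

theorem exists_runs_degreeProg : ∃ c, ∀ {n k : ℕ} {G₀ : SimpleGraph (Fin n)} {s : State}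
    {σ : Config n}, Stores G₀ k s σ → Runs degreeProg s (c * (n + k + 2) ^ 3) fun s' =>
      Stores G₀ k s' σ ∧ HoldsDegrees s' σ.G ∧ Keeps s s' := by
  obtain ⟨c₁, h₁⟩ := exists_runs_linear (p := .set 9 (.const 0)) trivial
  obtain ⟨c₂, h₂⟩ := exists_runs_linear (p := degreeStep) ⟨trivial, trivial⟩
  obtain ⟨c₃, h₃⟩ := exists_cost_le_linear cellsLeft
  refine ⟨c₁ + (1 + c₃ + c₂), fun {n k G₀ s σ} hs => ?_⟩
  have hcost := loop_cost_le (c := c₂) (c' := c₃) (j := 1) (mul_self_add_one_le n k)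
    (by omega) le_rfl
  rw [pow_one] at hcost
  refine ((h₁ n k s hs.base.bounded).seq (T' := (n * n + 1) * (1 + c₃ * (n + k + 2) +
    c₂ * (n + k + 2))) (R := fun s' => Stores G₀ k s' σ ∧ HoldsDegrees s' σ.G ∧ Keeps s s')
    ?_).mono ?_ fun _ h => h
  · rintro _ rfl
    have hinv : DegreeInv G₀ k σ s ((Program.set 9 (.const 0)).run s) :=
      ⟨hs.setCounter (Nat.zero_le _), (Keeps.refl s).setReg (by omega) _,
        by simp [Program.run, State.setReg, Expr.eval], fun v hv => by
          simp [Program.run, State.setReg, Expr.eval] at hv⟩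
    refine (Runs.while (I := DegreeInv G₀ k σ s) (μ := fun s' => n * n - s'.reg 9)
      (T := c₂ * (n + k + 2)) ?_
      (fun s' h => h₃ n k s' h.stores.base.bounded) hinv).mono ?_ ?_
    · intro s' h he
      rw [eval_cellsLeft_ne_zero h.stores.base.n_eq] at he
      refine (h₂ n k s' h.stores.base.bounded).mono le_rfl ?_
      rintro _ rfl
      obtain ⟨h4, h5⟩ := run_degreeStep h he
      exact ⟨h4, by rw [h5]; omega⟩
    · exact Nat.mul_le_mul_right _ (by omega)
    · rintro s' ⟨h, he⟩
      refine ⟨h.stores, fun v => ?_, h.keeps⟩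
      have h9 : s'.reg 9 = n * n := by
        have := mt (eval_cellsLeft_ne_zero h.stores.base.n_eq).2 (not_not.2 he)
        have := h.counter
        omega
      have hv : v * n < n * n := Nat.mul_lt_mul_of_pos_right v.2 (by have := v.2; omega)
      rw [h.sums v (h9 ▸ hv), h9, rowSum_eq_card h.stores.graph]
  · calc c₁ * (n + k + 2) + (n * n + 1) * (1 + c₃ * (n + k + 2) + c₂ * (n + k + 2))
        ≤ c₁ * (n + k + 2) ^ 3 + (1 + c₃ + c₂) * (n + k + 2) ^ 3 :=
          Nat.add_le_add (Nat.mul_le_mul_left _ (Nat.le_self_pow (by omega) _)) hcost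
      _ = (c₁ + (1 + c₃ + c₂)) * (n + k + 2) ^ 3 := by ring

/-- The invariant of the loop that copies the input matrix. -/
structure CopyInv {n : ℕ} (G₀ : SimpleGraph (Fin n)) (k : ℕ) (s s' : State) : Prop where
  base : Base G₀ k s'
  keeps : Keeps s s'
  counter : s'.reg 9 ≤ n * n
  copied : ∀ p < s'.reg 9, s'.arr 1 p = s'.arr 0 p

theorem run_copyStep {n k : ℕ} {G₀ : SimpleGraph (Fin n)} {s s' : State}
    (h : CopyInv G₀ k s s') (hlt : s'.reg 9 < n * n) :
    CopyInv G₀ k s (copyStep.run s') ∧ (copyStep.run s').reg 9 = s'.reg 9 + 1 := by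
  have hreg : (copyStep.run s').reg 9 = s'.reg 9 + 1 := by
    simp [copyStep, Program.run, State.setReg, State.setArr, Expr.eval, Op.eval]
  have hbase : Base G₀ k (s'.setArr 1 (s'.reg 9) (s'.arr 0 (s'.reg 9))) :=
    h.base.of_keeps ((Keeps.refl s').setArr (by omega) _ _)
      (h.base.bounded.setArr _ _ (h.base.bounded.2 _ _))
  refine ⟨⟨hbase.setCounter hlt, (h.keeps.setArr (by omega) _ _).setReg (by omega) _,
    hreg.trans_le hlt, fun p hp => ?_⟩, hreg⟩
  rw [hreg] at hp
  by_cases hp' : p = s'.reg 9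
  · simp [copyStep, Program.run, State.setArr, State.setReg, Expr.eval, hp']
  · simpa [copyStep, Program.run, State.setArr, State.setReg, Expr.eval, hp'] using
      h.copied p (by omega)

theorem exists_runs_copyProg : ∃ c, ∀ {n k : ℕ} {G₀ : SimpleGraph (Fin n)} {s : State},
    Base G₀ k s → Runs copyProg s (c * (n + k + 2) ^ 3) fun s' =>
      Base G₀ k s' ∧ HoldsGraph s' 1 G₀ ∧ Keeps s s' := by
  obtain ⟨c₁, h₁⟩ := exists_runs_linear (p := .set 9 (.const 0)) trivial
  obtain ⟨c₂, h₂⟩ := exists_runs_linear (p := copyStep) ⟨trivial, trivial⟩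
  obtain ⟨c₃, h₃⟩ := exists_cost_le_linear cellsLeft
  refine ⟨c₁ + (1 + c₃ + c₂), fun {n k G₀ s} hs => ?_⟩
  have hcost := loop_cost_le (c := c₂) (c' := c₃) (j := 1) (mul_self_add_one_le n k)
    (by omega) le_rfl
  rw [pow_one] at hcost
  refine ((h₁ n k s hs.bounded).seq (T' := (n * n + 1) * (1 + c₃ * (n + k + 2) +
    c₂ * (n + k + 2))) (R := fun s' => Base G₀ k s' ∧ HoldsGraph s' 1 G₀ ∧ Keeps s s')
    ?_).mono ?_ fun _ h => h
  · rintro _ rfl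
    have hinv : CopyInv G₀ k s ((Program.set 9 (.const 0)).run s) :=
      ⟨hs.setCounter (Nat.zero_le _), (Keeps.refl s).setReg (by omega) _,
        by simp [Program.run, State.setReg, Expr.eval], fun v hv => by
          simp [Program.run, State.setReg, Expr.eval] at hv⟩
    refine (Runs.while (I := CopyInv G₀ k s) (μ := fun s' => n * n - s'.reg 9)
      (T := c₂ * (n + k + 2)) ?_
      (fun s' h => h₃ n k s' h.base.bounded) hinv).mono ?_ ?_
    · intro s' h he
      rw [eval_cellsLeft_ne_zero h.base.n_eq] at he
      refine (h₂ n k s' h.base.bounded).mono le_rfl ?_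
      rintro _ rfl
      obtain ⟨h4, h5⟩ := run_copyStep h he
      exact ⟨h4, by rw [h5]; omega⟩
    · exact Nat.mul_le_mul_right _ (by omega)
    · rintro s' ⟨h, he⟩
      refine ⟨h.base, fun i j => ?_, h.keeps⟩
      have h9 : s'.reg 9 = n * n := by
        have := mt (eval_cellsLeft_ne_zero h.base.n_eq).2 (not_not.2 he)
        have := h.counter
        omega
      have hij : i * n + j < n * n := by
        have : (i + 1) * n ≤ n * n := Nat.mul_le_mul_right _ i.2
        rw [add_mul] at this
        have := j.2
        omega
      rw [h.copied _ (h9 ▸ hij), h.base.graph]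
  · calc c₁ * (n + k + 2) + (n * n + 1) * (1 + c₃ * (n + k + 2) + c₂ * (n + k + 2))
        ≤ c₁ * (n + k + 2) ^ 3 + (1 + c₃ + c₂) * (n + k + 2) ^ 3 :=
          Nat.add_le_add (Nat.mul_le_mul_left _ (Nat.le_self_pow (by omega) _)) hcost
      _ = (c₁ + (1 + c₃ + c₂)) * (n + k + 2) ^ 3 := by ring

end Bicluster


/-! ## Correctness and running time of the program -/

namespace Bicluster

open RAM

/-- A measure that decreases in every step of the search. -/
def Config.measure {n : ℕ} (σ : Config n) : ℕ := σ.j * (n ^ 6 + 2) + (n ^ 6 + 1 - σ.m)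

/-- A branch resets the position, which adds at most `n ^ 6 + 1` to the measure, but it uses up at
least one edit, worth `n ^ 6 + 2`. Rejection makes the second summand 0. -/
theorem Config.next_measure_lt {n : ℕ} {σ : Config n} (hm : σ.m < n ^ 6) (x : Fin 6 → Fin n) :
    (σ.next x rules).m ≤ n ^ 6 + 1 ∧ (σ.next x rules).measure < σ.measure := by
  rcases σ.next_cases x rules with ⟨-, h⟩ | ⟨ρ, hρ, -, h⟩
  · rw [h]
    simp only [measure]
    omega
  · rw [h]
    rcases σ.branch_cases x ρ.branches with h | ⟨b, hb, hj, h⟩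
    · rw [h]
      simp only [measure, abort]
      omega
    · rw [h]
      have hpos := ((rules_decodable ρ hρ).1 b hb).1
      simp only [measure, apply]
      have : (σ.j - b.pairs.length + 1) * (n ^ 6 + 2) ≤ σ.j * (n ^ 6 + 2) :=
        Nat.mul_le_mul_right _ (by omega)
      rw [add_mul] at this
      omega

/-- The invariant of the search loop. -/
def SearchInv {n : ℕ} (G₀ : SimpleGraph (Fin n)) (k : ℕ) (σ₀ : Config n) (s s' : State) : Prop :=
  ∃ σ : Config n, Stores G₀ k s' σ ∧ Keeps s s' ∧ σ.m ≤ n ^ 6 + 1 ∧ (σ.Accepts ↔ σ₀.Accepts)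

theorem Config.measure_eq {n k : ℕ} {G₀ : SimpleGraph (Fin n)} {s : State} {σ : Config n}
    (h : Stores G₀ k s σ) : s.reg 6 * (n ^ 6 + 2) + (n ^ 6 + 1 - s.reg 7) = σ.measure := by
  rw [h.j_eq, h.m_eq, measure]

theorem loopFree_toggleListProg (L : List (Fin 6 × Fin 6)) : (toggleListProg L).LoopFree := by
  induction L with
  | nil => trivial
  | cons e L ih => exact ⟨⟨trivial, trivial⟩, ih⟩

theorem loopFree_branchProg (bs : List Branch) : (branchProg bs).LoopFree := by
  induction bs with
  | nil => trivial
  | cons b bs ih =>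
    exact ⟨⟨trivial, loopFree_toggleListProg _, trivial, trivial, trivial⟩, ih⟩

theorem loopFree_rulesProg (rs : List Rule) : (rulesProg rs).LoopFree := by
  induction rs with
  | nil => trivial
  | cons ρ rs ih => exact ⟨loopFree_branchProg _, ih⟩

theorem loopFree_stepProg : stepProg.LoopFree :=
  ⟨trivial, trivial, trivial, trivial, trivial, trivial, loopFree_rulesProg _⟩

theorem exists_runs_searchProg : ∃ c, ∀ {n k : ℕ} {G₀ : SimpleGraph (Fin n)} {s : State}
    {σ₀ : Config n}, Stores G₀ k s σ₀ → σ₀.j = k → σ₀.m = 0 →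
      Runs searchProg s (c * (n + k + 2) ^ 10) fun s' =>
        Base G₀ k s' ∧ Keeps s s' ∧ (s'.reg 7 = n ^ 6 ↔ σ₀.Accepts) := by
  obtain ⟨c₁, h₁⟩ := exists_runs_degreeProg
  obtain ⟨c₂, h₂⟩ := exists_runs_linear loopFree_stepProg
  obtain ⟨c₃, h₃⟩ := exists_cost_le_linear (.op .lt (.reg 7) (.reg 8))
  refine ⟨1 + c₃ + (c₁ + c₂), fun {n k G₀ s σ₀} hs hj hm => ?_⟩
  -- The loop runs at most `(k + 1) * (n ^ 6 + 2)` times, hence the exponent 7. Recomputing the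
  -- degrees costs a cube in each round, which gives 10 in total.
  have hmeas : σ₀.measure + 1 ≤ (n + k + 2) ^ 7 := by
    have h6 : n ^ 6 + 2 ≤ (n + 2) ^ 6 := by
      nlinarith [Nat.zero_le n, Nat.zero_le (n ^ 2), Nat.zero_le (n ^ 3), Nat.zero_le (n ^ 4),
        Nat.zero_le (n ^ 5)]
    calc σ₀.measure + 1 = (k + 1) * (n ^ 6 + 2) := by rw [Config.measure, hj, hm]; ring_nf; omega
      _ ≤ (n + k + 2) * (n + k + 2) ^ 6 :=
          Nat.mul_le_mul (by omega) (h6.trans (Nat.pow_le_pow_left (by omega) 6))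
      _ = (n + k + 2) ^ 7 := by ring
  have hlt : ∀ {s' : State}, Base G₀ k s' →
      ((Expr.op .lt (.reg 7) (.reg 8)).eval s' ≠ 0 ↔ s'.reg 7 < n ^ 6) := fun {s'} h => by
    simp only [Expr.eval, Op.eval, h.tuples_eq]
    split_ifs with h <;> simp [h]
  refine (Runs.while (I := SearchInv G₀ k σ₀ s)
    (μ := fun s' => s'.reg 6 * (n ^ 6 + 2) + (n ^ 6 + 1 - s'.reg 7))
    (T := (c₁ + c₂) * (n + k + 2) ^ 3) ?_ (fun s' h => h₃ n k s' h.choose_spec.1.base.bounded)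
    ⟨σ₀, hs, Keeps.refl s, by omega, Iff.rfl⟩).mono ?_ ?_
  · rintro s' ⟨σ, hσ, hk, hle, hacc⟩ he
    rw [hlt hσ.base, hσ.m_eq] at he
    refine ((h₁ hσ).seq (T' := c₂ * (n + k + 2)) (R := fun s'' => SearchInv G₀ k σ₀ s s'' ∧
      s''.reg 6 * (n ^ 6 + 2) + (n ^ 6 + 1 - s''.reg 7) <
        s'.reg 6 * (n ^ 6 + 2) + (n ^ 6 + 1 - s'.reg 7)) ?_).mono ?_ fun _ h => h
    · rintro s₁ ⟨hσ₁, hd, hk₁⟩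
      refine (h₂ n k s₁ hσ₁.base.bounded).mono le_rfl ?_
      rintro _ rfl
      obtain ⟨hσ₂, hk₂⟩ := run_stepProg hσ₁ hd he
      obtain ⟨h4, h5⟩ := Config.next_measure_lt he (tuple he)
      refine ⟨⟨_, hσ₂, hk.trans (hk₁.trans hk₂), h4, (Config.accepts_iff he).symm.trans hacc⟩, ?_⟩
      rwa [Config.measure_eq hσ₂, Config.measure_eq hσ]
    · calc c₁ * (n + k + 2) ^ 3 + c₂ * (n + k + 2)
          ≤ c₁ * (n + k + 2) ^ 3 + c₂ * (n + k + 2) ^ 3 :=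
            Nat.add_le_add_left (Nat.mul_le_mul_left _ (Nat.le_self_pow (by omega) _)) _
        _ = (c₁ + c₂) * (n + k + 2) ^ 3 := by ring
  · simp only [Config.measure_eq hs]
    exact loop_cost_le hmeas (by omega) (by omega)
  · rintro s' ⟨⟨σ, hσ, hk, hle, hacc⟩, he⟩
    have hge := mt (hlt hσ.base).2 (not_not.2 he)
    rw [hσ.m_eq] at hge
    refine ⟨hσ.base, hk, ?_⟩
    rw [← hacc, Config.accepts_iff_of_le (not_lt.1 hge), hσ.m_eq]

-- The search overwrites its copy of the matrix, so each guess starts from a fresh copy of the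
-- input. Register 2 accumulates the disjunction of the results.
open Classical in
theorem exists_runs_guessProg : ∃ c, ∀ {n k : ℕ} {G₀ : SimpleGraph (Fin n)} {s : State},
    Base G₀ k s → s.reg 4 < 3 ^ k → Runs guessProg s (c * (n + k + 2) ^ 10) fun s' =>
      Base G₀ k s' ∧ s'.reg 4 = s.reg 4 + 1 ∧
        s'.reg 2 = if s.reg 2 ≠ 0 ∨ (Config.mk G₀ k (s.reg 4) 0).Accepts then 1 else 0 := by
  obtain ⟨c₁, h₁⟩ := exists_runs_copyProg
  obtain ⟨c₂, h₂⟩ := exists_runs_linear (p := startProg) ⟨trivial, trivial, trivial⟩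
  obtain ⟨c₃, h₃⟩ := exists_runs_searchProg
  obtain ⟨c₄, h₄⟩ := exists_runs_linear (p := recordProg) ⟨trivial, trivial⟩
  refine ⟨c₁ + (c₂ + (c₃ + c₄)), fun {n k G₀ s} hs hlt => ?_⟩
  refine ((h₁ hs).seq (T' := c₂ * (n + k + 2) + (c₃ * (n + k + 2) ^ 10 + c₄ * (n + k + 2)))
    (R := fun s' => Base G₀ k s' ∧ s'.reg 4 = s.reg 4 + 1 ∧ s'.reg 2 =
      if s.reg 2 ≠ 0 ∨ (Config.mk G₀ k (s.reg 4) 0).Accepts then 1 else 0) ?_).mono ?_ fun _ h => h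
  · rintro s₁ ⟨hb₁, hG₁, hk₁⟩
    refine (h₂ n k s₁ hb₁.bounded).seq ?_
    rintro _ rfl
    have hk₂ : Keeps s₁ (startProg.run s₁) :=
      (((Keeps.refl s₁).setReg (by omega) _).setReg (by omega) _).setReg (by omega) _
    have hst : Stores G₀ k (startProg.run s₁) ⟨G₀, k, s.reg 4, 0⟩ := by
      refine ⟨hb₁.of_keeps hk₂ (((hb₁.bounded.setReg _ (hb₁.bounded.1 4)).setReg _ ?_).setReg _
        (Nat.zero_le _)), hG₁, ?_, ?_, ?_⟩
      · simpa [Expr.eval, State.setReg, Program.run] using hb₁.bounded.1 1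
      · simpa [startProg, Program.run, Expr.eval, State.setReg] using hk₁.1 4 (by omega)
      · simpa [startProg, Program.run, Expr.eval, State.setReg] using hb₁.k_eq
      · simp [startProg, Program.run, Expr.eval, State.setReg]
    refine (h₃ hst rfl rfl).seq ?_
    rintro s₃ ⟨hb₃, hk₃, hacc⟩
    refine (h₄ n k s₃ hb₃.bounded).mono le_rfl ?_
    rintro _ rfl
    have hk := hk₁.trans (hk₂.trans hk₃)
    have h2 : s₃.reg 2 = s.reg 2 := hk.1 2 (by omega)
    have h4 : s₃.reg 4 = s.reg 4 := hk.1 4 (by omega)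
    have hbd : (recordProg.run s₃).Bounded (valueBound n k) := by
      refine (hb₃.bounded.setReg _ ?_).setReg _ ?_
      · have := two_le_valueBound n k
        exact (ite_le_one (Nat.le_refl 1) (Nat.zero_le 1)).trans (by omega)
      · have : (s₃.setReg 2 ((Expr.op .lt (.const 0)
            (.op .add (.reg 2) (.op .eq (.reg 7) (.reg 8)))).eval s₃)).reg 4 = s.reg 4 := by
          simpa [State.setReg] using h4
        simp only [Program.run, Expr.eval, Op.eval] at this ⊢
        rw [this, valueBound]
        have : 1 ≤ (n + 2) ^ 6 := Nat.one_le_pow _ _ (by omega)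
        omega
    refine ⟨⟨?_, ?_, ?_, ?_, ?_, hbd⟩, ?_, ?_⟩
    · simpa [recordProg, Program.run, State.setReg] using hb₃.n_eq
    · simpa [recordProg, Program.run, State.setReg] using hb₃.k_eq
    · simpa [recordProg, Program.run, State.setReg] using hb₃.guesses_eq
    · simpa [recordProg, Program.run, State.setReg] using hb₃.tuples_eq
    · exact hb₃.graph
    · simp [recordProg, Program.run, State.setReg, Expr.eval, Op.eval, h4]
    · simp only [← hacc]
      simp only [recordProg, Program.run, State.setReg, Expr.eval, Op.eval, h2, hb₃.tuples_eq]
      by_cases h5 : s₃.reg 7 = n ^ 6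
      · simp [h5]
      · simp [h5, Nat.pos_iff_ne_zero]
  · have hX : n + k + 2 ≤ (n + k + 2) ^ 10 := Nat.le_self_pow (by omega) _
    have hX3 : (n + k + 2) ^ 3 ≤ (n + k + 2) ^ 10 := Nat.pow_le_pow_right (by omega) (by omega)
    calc c₁ * (n + k + 2) ^ 3 +
          (c₂ * (n + k + 2) + (c₃ * (n + k + 2) ^ 10 + c₄ * (n + k + 2)))
        ≤ c₁ * (n + k + 2) ^ 10 + (c₂ * (n + k + 2) ^ 10 + (c₃ * (n + k + 2) ^ 10 +
          c₄ * (n + k + 2) ^ 10)) := by gcongr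
      _ = (c₁ + (c₂ + (c₃ + c₄))) * (n + k + 2) ^ 10 := by ring

/-- The invariant of the loop that computes the number of guesses. -/
structure InitInv {n : ℕ} (G₀ : SimpleGraph (Fin n)) (k : ℕ) (s : State) : Prop where
  n_eq : s.reg 0 = n
  k_eq : s.reg 1 = k
  result_eq : s.reg 2 = 0
  power_eq : s.reg 3 = 3 ^ s.reg 9
  guess_eq : s.reg 4 = 0
  counter : s.reg 9 ≤ k
  graph : HoldsGraph s 0 G₀
  bounded : s.Bounded (valueBound n k)

theorem bounded_input {n : ℕ} (G : SimpleGraph (Fin n)) (k : ℕ) :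
    (input G k).Bounded (valueBound n k) := by
  have h2 := two_le_valueBound n k
  have hn := le_valueBound n k
  have hk : k ≤ valueBound n k := (Nat.lt_pow_self (by omega)).le.trans (Nat.le_add_right (3 ^ k) _)
  refine ⟨fun x => ?_, fun a m => ?_⟩
  · simp only [input]
    split_ifs <;> omega
  · simp only [input]
    split_ifs <;> omega

theorem holdsGraph_input {n : ℕ} (G : SimpleGraph (Fin n)) (k : ℕ) :
    HoldsGraph (input G k) 0 G := by
  intro i j
  by_cases h : G.Adj i j
  · rw [adjBit_of_adj h]
    exact if_pos ⟨rfl, i, j, rfl, h⟩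
  · rw [adjBit_of_not_adj h]
    refine if_neg ?_
    rintro ⟨-, i', j', heq, h'⟩
    obtain ⟨rfl, rfl⟩ := cell_inj.1 heq
    exact h h'

/-- Registers 2, 4 and 9 (result, current guess, loop counter) are used without being set, since
they are 0 in the input state. -/
theorem exists_runs_initProg : ∃ c, ∀ {n : ℕ} (G₀ : SimpleGraph (Fin n)) (k : ℕ),
    Runs initProg (input G₀ k) (c * (n + k + 2) ^ 10) fun s =>
      Base G₀ k s ∧ s.reg 2 = 0 ∧ s.reg 4 = 0 := by
  obtain ⟨c₁, h₁⟩ := exists_runs_linear (p := .set 3 (.const 1)) trivial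
  obtain ⟨c₂, h₂⟩ := exists_runs_linear (p := .seq (.set 3 (.op .mul (.const 3) (.reg 3)))
    (.set 9 (.op .add (.reg 9) (.const 1)))) ⟨trivial, trivial⟩
  obtain ⟨c₃, h₃⟩ := exists_cost_le_linear (.op .lt (.reg 9) (.reg 1))
  obtain ⟨c₄, h₄⟩ := exists_runs_linear (p := .set 8 (powExpr 6)) trivial
  refine ⟨c₁ + ((1 + c₃ + c₂) + c₄), fun {n} G₀ k => ?_⟩
  have h2V := two_le_valueBound n k
  have hlt : ∀ {s : State}, InitInv G₀ k s →
      ((Expr.op .lt (.reg 9) (.reg 1)).eval s ≠ 0 ↔ s.reg 9 < k) := fun {s} h => by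
    simp only [Expr.eval, Op.eval, h.k_eq]
    split_ifs with h <;> simp [h]
  refine ((h₁ n k _ (bounded_input G₀ k)).seq (T' := (k + 1) * (1 + c₃ * (n + k + 2) +
    c₂ * (n + k + 2)) + c₄ * (n + k + 2)) (R := fun s => Base G₀ k s ∧ s.reg 2 = 0 ∧ s.reg 4 = 0)
    ?_).mono ?_ fun _ h => h
  · rintro _ rfl
    have hinv : InitInv G₀ k ((Program.set 3 (.const 1)).run (input G₀ k)) := by
      refine ⟨?_, ?_, ?_, ?_, ?_, ?_, holdsGraph_input G₀ k,
        (bounded_input G₀ k).setReg _ (by simp only [Expr.eval]; omega)⟩ <;>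
      simp [Program.run, State.setReg, input, Expr.eval]
    refine Runs.seq (Q := fun s => InitInv G₀ k s ∧ s.reg 9 = k)
      ((Runs.while (I := InitInv G₀ k) (μ := fun s => k - s.reg 9) (T := c₂ * (n + k + 2)) ?_
      (fun s' h => h₃ n k s' h.bounded) hinv).mono (Nat.mul_le_mul_right _ (Nat.succ_le_succ (Nat.sub_le _ _))) ?_) ?_
    · intro s h he
      rw [hlt h] at he
      refine (h₂ n k s h.bounded).mono le_rfl ?_
      rintro _ rfl
      have hpow : 3 * s.reg 3 = 3 ^ (s.reg 9 + 1) := by rw [h.power_eq, pow_succ, mul_comm]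
      have hrun : (Program.seq (.set 3 (.op .mul (.const 3) (.reg 3)))
          (.set 9 (.op .add (.reg 9) (.const 1)))).run s =
          (s.setReg 3 (3 ^ (s.reg 9 + 1))).setReg 9 (s.reg 9 + 1) := by
        rw [← hpow]
        simp [Program.run, State.setReg, Expr.eval, Op.eval]
      rw [hrun]
      have hle : 3 ^ (s.reg 9 + 1) ≤ valueBound n k :=
        (Nat.pow_le_pow_right (by omega) he).trans (Nat.le_add_right _ _)
      refine ⟨⟨?_, ?_, ?_, ?_, ?_, ?_, h.graph, (h.bounded.setReg _ hle).setReg _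
        ((Nat.lt_pow_self (by omega)).le.trans hle)⟩, ?_⟩
      · simpa [State.setReg] using h.n_eq
      · simpa [State.setReg] using h.k_eq
      · simpa [State.setReg] using h.result_eq
      · simp [State.setReg]
      · simpa [State.setReg] using h.guess_eq
      · simpa [State.setReg] using he
      · simp only [State.setReg, Function.update_self]
        omega
    · rintro s ⟨h, he⟩
      have := mt (hlt h).2 (not_not.2 he)
      have := h.counter
      exact ⟨h, by omega⟩
    · rintro s ⟨h, h9⟩
      refine (h₄ n k s h.bounded).mono le_rfl ?_
      rintro _ rfl
      have hrun : (Program.set 8 (powExpr 6)).run s = s.setReg 8 (n ^ 6) := by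
        rw [Program.run, eval_powExpr h.n_eq]
      rw [hrun]
      refine ⟨⟨?_, ?_, ?_, ?_, h.graph, h.bounded.setReg _ (pow_six_lt_valueBound n k).le⟩, ?_, ?_⟩
      · simpa [State.setReg] using h.n_eq
      · simpa [State.setReg] using h.k_eq
      · simpa [State.setReg, h9] using h.power_eq
      · simp [State.setReg]
      · simpa [State.setReg] using h.result_eq
      · simpa [State.setReg] using h.guess_eq
  · have hX : n + k + 2 ≤ (n + k + 2) ^ 10 := Nat.le_self_pow (by omega) _
    have hcost := loop_cost_le (a := k + 1) (X := n + k + 2) (c := c₂) (c' := c₃) (i := 1) (j := 1)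
      (by rw [pow_one]; omega) (by omega) le_rfl
    rw [pow_one] at hcost
    have hcost' := hcost.trans (Nat.mul_le_mul_left (1 + c₃ + c₂)
      (Nat.pow_le_pow_right (by omega : 0 < n + k + 2) (by omega : 1 + 1 ≤ 10)))
    calc c₁ * (n + k + 2) + ((k + 1) * (1 + c₃ * (n + k + 2) + c₂ * (n + k + 2)) +
          c₄ * (n + k + 2))
        ≤ c₁ * (n + k + 2) ^ 10 + ((1 + c₃ + c₂) * (n + k + 2) ^ 10 +
          c₄ * (n + k + 2) ^ 10) := by gcongr
      _ = (c₁ + ((1 + c₃ + c₂) + c₄)) * (n + k + 2) ^ 10 := by ring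

open Classical in
/-- The program decides Bicluster Editing within `3 ^ k` times a polynomial. -/
theorem exists_runs_mainProg : ∃ c, ∀ {n : ℕ} (G : SimpleGraph (Fin n)) (k : ℕ),
    Runs mainProg (input G k) (c * (3 ^ k * (n + k + 2) ^ 10)) fun s =>
      s.reg 0 = if BiclusterEditing G k then 1 else 0 := by
  obtain ⟨c₁, h₁⟩ := exists_runs_initProg
  obtain ⟨c₂, h₂⟩ := exists_runs_guessProg
  obtain ⟨c₃, h₃⟩ := exists_cost_le_linear (.op .lt (.reg 4) (.reg 3))
  obtain ⟨c₄, h₄⟩ := exists_runs_linear (p := .set 0 (.reg 2)) trivial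
  refine ⟨c₁ + (2 * (1 + c₃ + c₂) + c₄), fun {n} G k => ?_⟩
  have hlt : ∀ {s : State}, Base G k s →
      ((Expr.op .lt (.reg 4) (.reg 3)).eval s ≠ 0 ↔ s.reg 4 < 3 ^ k) := fun {s} h => by
    simp only [Expr.eval, Op.eval, h.guesses_eq]
    split_ifs with h <;> simp [h]
  refine ((h₁ G k).seq (T' := (3 ^ k + 1) * (1 + c₃ * (n + k + 2) + c₂ * (n + k + 2) ^ 10) +
    c₄ * (n + k + 2)) (R := fun s => s.reg 0 = if BiclusterEditing G k then 1 else 0)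
    ?_).mono ?_ fun _ h => h
  · rintro s₁ ⟨hb₁, hr₁, hg₁⟩
    refine Runs.seq (Q := fun s => Base G k s ∧ s.reg 2 = if BiclusterEditing G k then 1 else 0)
      ((Runs.while (I := fun s => Base G k s ∧ s.reg 4 ≤ 3 ^ k ∧ s.reg 2 =
        if ∃ r < s.reg 4, (Config.mk G k r 0).Accepts then 1 else 0) (μ := fun s => 3 ^ k - s.reg 4)
      (T := c₂ * (n + k + 2) ^ 10) ?_ (fun s' h => h₃ n k s' h.1.bounded) ⟨hb₁, ?_⟩).mono
        (Nat.mul_le_mul_right _ (Nat.succ_le_succ (Nat.sub_le _ _))) ?_) ?_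
    · rintro s ⟨hb, hle, hr⟩ he
      rw [hlt hb] at he
      refine (h₂ hb he).mono le_rfl ?_
      rintro s' ⟨hb', h4, hr'⟩
      refine ⟨⟨hb', by omega, ?_⟩, by omega⟩
      rw [hr', h4, hr]
      refine if_congr ?_ rfl rfl
      rw [ite_ne_right_iff, and_iff_left one_ne_zero]
      constructor
      · rintro (⟨r, hr, h⟩ | h)
        exacts [⟨r, by omega, h⟩, ⟨_, Nat.lt_succ_self _, h⟩]
      · rintro ⟨r, hr, h⟩
        rcases Nat.lt_succ_iff_lt_or_eq.1 hr with hr | rfl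
        exacts [Or.inl ⟨r, hr, h⟩, Or.inr h]
    · simp [hr₁, hg₁]
    · rintro s ⟨⟨hb, hle, hr⟩, he⟩
      have h4 : s.reg 4 = 3 ^ k := by
        have := mt (hlt hb).2 (not_not.2 he)
        omega
      rw [h4] at hr
      exact ⟨hb, hr.trans (if_congr biclusterEditing_iff_exists_accepts.symm rfl rfl)⟩
    · rintro s ⟨hb, hr⟩
      refine (h₄ n k s hb.bounded).mono le_rfl ?_
      rintro _ rfl
      rw [← hr]
      simp [Program.run, State.setReg, Expr.eval]
  · have h3 : 1 ≤ 3 ^ k := Nat.one_le_pow _ _ (by omega)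
    have hX : n + k + 2 ≤ (n + k + 2) ^ 10 := Nat.le_self_pow (by omega) _
    have hX1 : 1 ≤ (n + k + 2) ^ 10 := Nat.one_le_pow _ _ (by omega)
    have hX' : (n + k + 2) ^ 10 ≤ 3 ^ k * (n + k + 2) ^ 10 := Nat.le_mul_of_pos_left _ h3
    calc c₁ * (n + k + 2) ^ 10 + ((3 ^ k + 1) * (1 + c₃ * (n + k + 2) + c₂ * (n + k + 2) ^ 10) +
          c₄ * (n + k + 2))
        ≤ c₁ * (3 ^ k * (n + k + 2) ^ 10) + ((3 ^ k + 3 ^ k) * ((n + k + 2) ^ 10 +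
          c₃ * (n + k + 2) ^ 10 + c₂ * (n + k + 2) ^ 10) + c₄ * (3 ^ k * (n + k + 2) ^ 10)) := by
          gcongr
          exact hX.trans hX'
      _ = (c₁ + (2 * (1 + c₃ + c₂) + c₄)) * (3 ^ k * (n + k + 2) ^ 10) := by ring

/-- The sequence `m ^ 10 * (3 / 3.116) ^ m` tends to 0, hence is bounded. Evaluating it at `m = k +
2` explains the divisor `(3 / 3.116) ^ 2`. -/
theorem exists_three_pow_mul_le : ∃ C : ℕ, ∀ k : ℕ,
    (3 : ℝ) ^ k * ((k : ℝ) + 2) ^ 10 ≤ C * (3.116 : ℝ) ^ k := by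
  have hlim := tendsto_pow_const_mul_const_pow_of_abs_lt_one 10 (r := 3 / 3.116) (by norm_num)
  obtain ⟨M, hM⟩ := hlim.bddAbove_range
  obtain ⟨C, hC⟩ := exists_nat_ge (M / (3 / 3.116) ^ 2)
  refine ⟨C, fun k => ?_⟩
  have h1 : (((k + 2 : ℕ) : ℝ)) ^ 10 * (3 / 3.116) ^ (k + 2) ≤ M := hM ⟨k + 2, rfl⟩
  have h2 : ((k : ℝ) + 2) ^ 10 * (3 / 3.116) ^ k ≤ C := by
    refine le_trans ?_ hC
    rw [le_div_iff₀ (by norm_num)]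
    refine le_trans (le_of_eq ?_) h1
    push_cast
    ring
  calc (3 : ℝ) ^ k * ((k : ℝ) + 2) ^ 10
      = ((k : ℝ) + 2) ^ 10 * (3 / 3.116) ^ k * 3.116 ^ k := by
        rw [mul_assoc, ← mul_pow, div_mul_cancel₀ _ (by norm_num), mul_comm]
    _ ≤ C * (3.116 : ℝ) ^ k := mul_le_mul_of_nonneg_right h2 (by positivity)

end Bicluster

/-- One program decides every instance `(G, k)` of Bicluster Editing in time
`O*(3.116 ^ k)`, i.e. `3.116 ^ k` times a polynomial in the number of vertices of `G` and the number
of bits of `k`. -/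
theorem mainTheorem1 :
    ∃ (p : RAM.Program) (C d : ℕ), ∀ (n : ℕ) (G : SimpleGraph (Fin n)) (k : ℕ),
      RAM.DecidesWithin p (RAM.input G k) (BiclusterEditing G k)
        (C * (3.116 : ℝ) ^ k * ((n : ℝ) + Nat.size k + 1) ^ d) := by
  obtain ⟨c, hc⟩ := Bicluster.exists_runs_mainProg
  obtain ⟨C, hC⟩ := Bicluster.exists_three_pow_mul_le
  refine ⟨Bicluster.mainProg, c * C, 10, fun n G k => ?_⟩
  obtain ⟨s, t, hex, ht, hres⟩ := hc G k
  refine ⟨s, t, hex, ?_, fun h => by rw [hres, if_pos h], fun h => by rw [hres, if_neg h]⟩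
  calc (t : ℝ) ≤ c * (3 ^ k * ((n : ℝ) + k + 2) ^ 10) := by exact_mod_cast ht
    _ ≤ c * (3 ^ k * (((k : ℝ) + 2) * ((n : ℝ) + Nat.size k + 1)) ^ 10) := by
        -- Splitting the sum into a product separates `k`, whose power goes into the exponential,
        -- from `n`, whose power remains.
        have h1 : (n : ℝ) + k + 2 ≤ ((k : ℝ) + 2) * ((n : ℝ) + Nat.size k + 1) := by
          have hn : (0 : ℝ) ≤ n := Nat.cast_nonneg n
          have hk : (0 : ℝ) ≤ k := Nat.cast_nonneg k
          have hs : (0 : ℝ) ≤ Nat.size k := Nat.cast_nonneg _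
          nlinarith [mul_nonneg hk hn, mul_nonneg hk hs]
        gcongr
    _ = c * (3 ^ k * ((k : ℝ) + 2) ^ 10) * ((n : ℝ) + Nat.size k + 1) ^ 10 := by ring
    _ ≤ c * (C * (3.116 : ℝ) ^ k) * ((n : ℝ) + Nat.size k + 1) ^ 10 := by
        exact mul_le_mul_of_nonneg_right (mul_le_mul_of_nonneg_left (hC k) (by positivity))
          (by positivity)
    _ = ((c * C : ℕ) : ℝ) * (3.116 : ℝ) ^ k * ((n : ℝ) + Nat.size k + 1) ^ 10 := by
        push_cast
        ring
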